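/- **Setting.** A BMS channel $P$ has input alphabet $\{0,1\}$, an output alphabet $\mathcal Y$ carrying a $\sigma$-finite reference measure $\nu$ (counting measure if $P$ is discrete, so that integrals are sums), transition probabilities (densities with respect to $\nu$) $P(y|x)$, and a $\nu$-preserving involution $\pi$ of $\mathcal Y$ with $P(y|1)=P(\pi(y)|0)$. Put $$Z(P)=\int\sqrt{P(y|0)P(y|1)}\,d\nu(y),\qquad I(P)=\int\sum_{x}\tfrac12P(y|x)\log_2\frac{P(y|x)}{\frac12P(y|0)+\frac12P(y|1)}\,d\nu(y),$$ $$P^-(y_1,y_2|x_1)=\sum_{x_2}\tfrac12P(y_1|x_1\oplus x_2)P(y_2|x_2),\qquad P^+(y_1,y_2,x_1|x_2)=\tfrac12P(y_1|x_1\oplus x_2)P(y_2|x_2).$$ The polarization tree of $W$ has $W$ at the root and $P^-$, $P^+$ as left and right child of $P$; $W_N^{(1)},\dots,W_N^{(N)}$ are the $N=2^n$ channels at level $n$, from left to right. A quantization scheme $Q_k$ assigns to every BMS channel a BMS channel with at most $k$ output symbols. The quantized tree has $\tilde W=Q_k(W)$ at the root, and the children of a node $\tilde P$ are $Q_k(\tilde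 P^-)$ and $Q_k(\tilde P^+)$; its channels at level $n$ are $\tilde W_N^{(i)}$. $Q_k$ is *admissible* if $Z(\tilde W_N^{(i)})\ge Z(W_N^{(i)})$ for all BMS channels $W$, all $n$ and all $i$. Put $$\rho(Q_k,W)=\lim_{n\to\infty}\frac{|\{i: I(\tilde W_N^{(i)})>\frac12\}|}{N}.$$ **Mass algorithms.** A BMS channel with finite output alphabet is described by a list $(p_1,x_1),\dots,(p_m,x_m)$ with $p_i>0$, $\sum_i p_i=1$, $0\le x_1<\dots<x_m\le\frac12$: with probability $p_i$ the input is sent over a binary symmetric channel with crossover probability $x_i$. Let $f$ be an increasing function on $[0,\frac12]$. The *mass transportation algorithm* repeats: choose $j$ minimizing $p_i(f(x_{i+1})-f(x_i))$ and replace $(p_j,x_j),(p_{j+1},x_{j+1})$ by $(p_j+p_{j+1},x_{j+1})$. The *mass merging algorithm*, for $f$ increasing and concave, repeats: choose $j$ minimizing $p_i(f(\bar x_i)-f(x_i))-p_{i+1}(f(x_{i+1})-f(\bar x_i))$, where $\bar x_i=\frac{p_ix_i+p_{i+1}x_{i+1}}{p_i+p_{i+1}}$, and replace $(p_j,x_j),(p_{j+1},x_{j+1})$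 by $(p_j+p_{j+1},\bar x_j)$. Either one stops when at most $\lfloor k/2\rfloor$ masses, that is at most $k$ output symbols, are left; ties are broken by the smallest $j$. **Theorem.** Let $W$ be a BMS channel, fix one of the two algorithms and a function $f$ as above, and let $\varepsilon>0$. There is $\delta_0>0$ such that for every $\delta\in(0,\delta_0]$ there is $K$ such that for every $k\ge K$ there is an admissible quantization scheme $Q_k$ with the following properties: $Q_k(P)=\mathrm{BEC}(Z(P))$ for every BMS channel $P$ with $Z(P)<\delta$; $Q_k(P)$ is the output of the algorithm for every BMS channel $P$ with finite output alphabet and $Z(P)\ge\delta$; the limit $\rho(Q_k,W)$ exists; and $$|\rho(Q_k,W)-I(W)|<\varepsilon .$$ -/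

import Mathlib

open MeasureTheory Set Filter Topology

noncomputable section

/-- A binary-input memoryless symmetric channel.  Its transition law is given by densities
`w x y = P(y | x)` with respect to a σ-finite reference measure `ν` on the output alphabet
(counting measure for discrete channels).  Symmetry: a `ν`-preserving involution `π` of the
output alphabet exchanges the two conditional laws. -/
structure BMS where
  Y : Type
  [mY : MeasurableSpace Y]
  ν : Measure Y
  [sigmaFinite : SigmaFinite ν]
  w : Bool → Y → ℝ
  measurable_w : ∀ x, Measurable (w x)
  w_nonneg : ∀ x y, 0 ≤ w x y
  integral_w : ∀ x, ∫ y, w x y ∂ν = 1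
  π : Y → Y
  π_invol : Function.Involutive π
  π_preserving : MeasurePreserving π ν ν
  w_symm : ∀ x y, w (!x) y = w x (π y)

attribute [instance] BMS.mY BMS.sigmaFinite

namespace BMS

theorem integrable_w (P : BMS) (x : Bool) : Integrable (P.w x) P.ν := by
  by_contra h
  have := P.integral_w x
  rw [integral_undef h] at this
  exact zero_ne_one this

/-- Bhattacharyya parameter `Z(P)`. -/
def Z (P : BMS) : ℝ := ∫ y, Real.sqrt (P.w false y * P.w true y) ∂P.ν

/-- Mutual information in bits between a uniform input and the output
(the symmetric capacity `I(P)`). -/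
def I (P : BMS) : ℝ :=
  ∫ y, ∑ x : Bool, 1 / 2 * P.w x y *
    Real.logb 2 (P.w x y / (1 / 2 * P.w false y + 1 / 2 * P.w true y)) ∂P.ν

theorem Z_nonneg (P : BMS) : 0 ≤ P.Z := integral_nonneg fun _ => Real.sqrt_nonneg _

theorem Z_le_one (P : BMS) : P.Z ≤ 1 := by
  have h : ∫ y, (P.w false y + P.w true y) / 2 ∂P.ν = 1 := by
    rw [integral_div, integral_add (P.integrable_w _) (P.integrable_w _), P.integral_w,
      P.integral_w]
    norm_num
  rw [← h]
  refine integral_mono_of_nonneg (Eventually.of_forall fun _ => Real.sqrt_nonneg _)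
    (((P.integrable_w _).add (P.integrable_w _)).div_const 2)
    (Eventually.of_forall fun y => ?_)
  have h0 := P.w_nonneg false y
  have h1 := P.w_nonneg true y
  refine Real.sqrt_le_iff.2 ⟨by positivity, ?_⟩
  nlinarith [sq_nonneg (P.w false y - P.w true y)]

/-- `P⁻(y₁, y₂ | x₁) = ∑_{x₂} ½ P(y₁ | x₁ ⊕ x₂) P(y₂ | x₂)`. -/
def minus (P : BMS) : BMS where
  Y := P.Y × P.Y
  ν := P.ν.prod P.ν
  w x₁ y := ∑ x₂ : Bool, 1 / 2 * P.w (xor x₁ x₂) y.1 * P.w x₂ y.2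
  measurable_w x₁ := by
    refine Finset.measurable_sum _ fun x₂ _ => ?_
    exact (((P.measurable_w _).comp measurable_fst).const_mul _).mul
      ((P.measurable_w _).comp measurable_snd)
  w_nonneg x₁ y := Finset.sum_nonneg fun x₂ _ =>
    mul_nonneg (mul_nonneg (by norm_num) (P.w_nonneg _ _)) (P.w_nonneg _ _)
  integral_w x₁ := by
    rw [integral_finsetSum]
    · have h : ∀ x₂ : Bool, ∫ y : P.Y × P.Y, 1 / 2 * P.w (xor x₁ x₂) y.1 * P.w x₂ y.2
          ∂(P.ν.prod P.ν) = 1 / 2 := fun x₂ => by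
        rw [integral_prod_mul (fun y => 1 / 2 * P.w (xor x₁ x₂) y) (P.w x₂),
          integral_const_mul, P.integral_w, P.integral_w]
        norm_num
      simp only [h]
      norm_num
    · intro x₂ _
      exact Integrable.mul_prod ((P.integrable_w _).const_mul _) (P.integrable_w _)
  π := fun y => (P.π y.1, y.2)
  π_invol := fun y => by simp [P.π_invol y.1]
  π_preserving := P.π_preserving.prod (MeasurePreserving.id _)
  w_symm x₁ y := by
    refine Finset.sum_congr rfl fun x₂ _ => ?_
    rw [← P.w_symm]
    simp

/-- `P⁺(y₁, y₂, x₁ | x₂) = ½ P(y₁ | x₁ ⊕ x₂) P(y₂ | x₂)`. -/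
def plus (P : BMS) : BMS where
  Y := P.Y × P.Y × Bool
  ν := P.ν.prod (P.ν.prod Measure.count)
  w x₂ y := 1 / 2 * P.w (xor y.2.2 x₂) y.1 * P.w x₂ y.2.1
  measurable_w x₂ := by
    have h : Measurable fun y : P.Y × P.Y × Bool => P.w (xor y.2.2 x₂) y.1 := by
      have : Measurable fun q : Bool × P.Y => P.w (xor q.1 x₂) q.2 :=
        measurable_from_prod_countable_right fun b => P.measurable_w (xor b x₂)
      exact this.comp ((measurable_snd.comp measurable_snd).prodMk measurable_fst)
    exact (h.const_mul _).mul
      ((P.measurable_w _).comp (measurable_fst.comp measurable_snd))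
  w_nonneg x₂ y := mul_nonneg (mul_nonneg (by norm_num) (P.w_nonneg _ _)) (P.w_nonneg _ _)
  integral_w x₂ := by
    have e : ∀ y : P.Y × P.Y × Bool, 1 / 2 * P.w (xor y.2.2 x₂) y.1 * P.w x₂ y.2.1 =
        ∑ b : Bool, (1 / 2 * P.w (xor b x₂) y.1) *
          (P.w x₂ y.2.1 * if y.2.2 = b then 1 else 0) := by
      rintro ⟨y₁, y₂, u⟩
      cases u <;> simp
    have hi : ∀ b : Bool, Integrable (fun u : Bool => if u = b then (1 : ℝ) else 0)
        Measure.count := fun b => Integrable.of_finite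
    simp only [e]
    rw [integral_finsetSum]
    · have h : ∀ b : Bool, ∫ y : P.Y × P.Y × Bool, (1 / 2 * P.w (xor b x₂) y.1) *
          (P.w x₂ y.2.1 * if y.2.2 = b then 1 else 0)
          ∂(P.ν.prod (P.ν.prod Measure.count)) = 1 / 2 := fun b => by
        rw [integral_prod_mul (fun y => 1 / 2 * P.w (xor b x₂) y)
            (fun z : P.Y × Bool => P.w x₂ z.1 * if z.2 = b then (1 : ℝ) else 0),
          integral_prod_mul (P.w x₂) (fun u : Bool => if u = b then (1 : ℝ) else 0),
          integral_const_mul, P.integral_w, P.integral_w, integral_count]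
        simp
      simp only [h]
      norm_num
    · intro b _
      exact Integrable.mul_prod ((P.integrable_w _).const_mul _)
        (Integrable.mul_prod (P.integrable_w _) (hi b))
  π := fun y => (P.π y.1, P.π y.2.1, y.2.2)
  π_invol := fun y => by simp [P.π_invol y.1, P.π_invol y.2.1]
  π_preserving := P.π_preserving.prod (P.π_preserving.prod (MeasurePreserving.id _))
  w_symm x₂ y := by
    simp only [← P.w_symm, Bool.xor_not]

/-- The two children in the polarization tree: `false` is left (`P⁻`), `true` is right (`P⁺`). -/
def child (P : BMS) (b : Bool) : BMS := if b then P.plus else P.minus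

/-- The channels at level `n` of the polarization tree, from left to right; only the indices
`i < 2 ^ n` are meaningful. -/
def sub (W : BMS) : ℕ → ℕ → BMS
  | 0, _ => W
  | n + 1, i => (sub W n (i / 2)).child (i % 2 == 1)

/-- The tree in which every channel is quantized by `Q` as soon as it is formed, the root included,
and the children are formed from the quantized channel. -/
def quantSub (Q : BMS → BMS) (W : BMS) : ℕ → ℕ → BMS
  | 0, _ => Q W
  | n + 1, i => Q ((quantSub Q W n (i / 2)).child (i % 2 == 1))

/-- The binary erasure channel with erasure probability `e`; the output `none` is the erasure. -/
def bec (e : ℝ) (h0 : 0 ≤ e) (h1 : e ≤ 1) : BMS where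
  Y := Option Bool
  mY := ⊤
  ν := @Measure.count _ ⊤
  sigmaFinite := by
    let _ : MeasurableSpace (Option Bool) := ⊤
    infer_instance
  w x y := y.elim e fun c => if c = x then 1 - e else 0
  measurable_w x := measurable_from_top
  w_nonneg x y := by
    rcases y with _ | c
    · exact h0
    · simp only [Option.elim]
      split_ifs <;> linarith
  integral_w x := by
    let _ : MeasurableSpace (Option Bool) := ⊤
    rw [integral_count]
    cases x <;> simp [Fintype.sum_option]
  π := Option.map not
  π_invol := fun y => by cases y <;> simp
  π_preserving := by
    let _ : MeasurableSpace (Option Bool) := ⊤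
    have hinv : Function.Involutive (Option.map not) := fun y => by cases y <;> simp
    refine ⟨measurable_from_top, ?_⟩
    ext s hs
    rw [Measure.map_apply measurable_from_top hs, ← hinv.image_eq_preimage_symm,
      Measure.count_injective_image hinv.injective]
  w_symm x y := by
    rcases y with _ | c
    · rfl
    · cases x <;> cases c <;> rfl

/-! ### Mass representation of discrete channels -/

/-- The crossover probability carried by the output symbol `y`
(irrelevant if `y` has probability zero). -/
def chi (P : BMS) (y : P.Y) : ℝ :=
  min (P.w false y) (P.w true y) / (P.w false y + P.w true y)

theorem chi_mem (P : BMS) (y : P.Y) : 0 ≤ P.chi y ∧ P.chi y ≤ 1 / 2 := by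
  have h0 := P.w_nonneg false y
  have h1 := P.w_nonneg true y
  refine ⟨div_nonneg (le_min h0 h1) (add_nonneg h0 h1), ?_⟩
  refine div_le_of_le_mul₀ (add_nonneg h0 h1) (by norm_num) ?_
  have := min_le_left (P.w false y) (P.w true y)
  have := min_le_right (P.w false y) (P.w true y)
  linarith

/-- The probability, under uniform input, that the output has crossover probability `x`. -/
def chiMass (P : BMS) (x : ℝ) : ℝ :=
  ∫ y in P.chi ⁻¹' {x}, (P.w false y + P.w true y) / 2 ∂P.ν

theorem chiMass_nonneg (P : BMS) (x : ℝ) : 0 ≤ P.chiMass x :=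
  integral_nonneg fun y =>
    div_nonneg (add_nonneg (P.w_nonneg false y) (P.w_nonneg true y)) (by norm_num)

theorem measurable_chi (P : BMS) : Measurable P.chi :=
  ((P.measurable_w _).min (P.measurable_w _)).div ((P.measurable_w _).add (P.measurable_w _))

open Classical in
/-- The positions `x` carrying positive mass, for a finite output alphabet. -/
def positions (P : BMS) [Finite P.Y] : Finset ℝ :=
  (Set.finite_range P.chi).toFinset.filter fun x => 0 < P.chiMass x

/-- The list `(p₁, x₁), …, (p_m, x_m)`, `x₁ < ⋯ < x_m`, of the masses of a channel with finite
output alphabet: `p_i > 0` is the probability of the crossover probability `x_i ∈ [0, 1/2]`. -/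
def masses (P : BMS) [Finite P.Y] : List (ℝ × ℝ) :=
  (P.positions.sort (· ≤ ·)).map fun x => (P.chiMass x, x)

end BMS

/-- A list of masses `(p_i, x_i)` that describes a probability distribution on `[0, 1/2]`. -/
def IsMassList (l : List (ℝ × ℝ)) : Prop :=
  (∀ a ∈ l, 0 < a.1 ∧ 0 ≤ a.2 ∧ a.2 ≤ 1 / 2) ∧ (l.map Prod.fst).sum = 1

theorem BMS.isMassList_masses (P : BMS) [Finite P.Y] : IsMassList P.masses := by
  classical
  constructor
  · intro a ha
    simp only [BMS.masses, List.mem_map, Finset.mem_sort, BMS.positions, Finset.mem_filter,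
      Set.Finite.mem_toFinset, Set.mem_range] at ha
    obtain ⟨x, ⟨⟨y, rfl⟩, hx⟩, rfl⟩ := ha
    exact ⟨hx, P.chi_mem y⟩
  · have h1 : (P.masses.map Prod.fst).sum = ∑ x ∈ P.positions, P.chiMass x := by
      simp only [BMS.masses, List.map_map]
      rw [← Finset.sum_map_toList]
      exact ((Finset.sort_perm_toList P.positions (· ≤ ·)).map _).sum_eq
    have h2 : ∑ x ∈ P.positions, P.chiMass x =
        ∑ x ∈ (Set.finite_range P.chi).toFinset, P.chiMass x := by
      refine Finset.sum_subset (Finset.filter_subset _ _) fun x hx hx' => ?_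
      by_contra hne
      exact hx' (Finset.mem_filter.2 ⟨hx, lt_of_le_of_ne (P.chiMass_nonneg x) (Ne.symm hne)⟩)
    have hint : Integrable (fun y => (P.w false y + P.w true y) / 2) P.ν :=
      ((P.integrable_w _).add (P.integrable_w _)).div_const 2
    have h3 : ∑ x ∈ (Set.finite_range P.chi).toFinset, P.chiMass x =
        ∫ y in ⋃ x ∈ (Set.finite_range P.chi).toFinset, P.chi ⁻¹' {x},
          (P.w false y + P.w true y) / 2 ∂P.ν := by
      refine (integral_biUnion_finset _ (fun x _ => P.measurable_chi (measurableSet_singleton x))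
        ?_ fun x _ => hint.integrableOn).symm
      intro x _ x' _ hne
      exact Disjoint.preimage _ (by simpa using hne)
    have h4 : (⋃ x ∈ (Set.finite_range P.chi).toFinset, P.chi ⁻¹' {x}) = Set.univ := by
      ext y
      simp
    rw [h1, h2, h3, h4, setIntegral_univ, integral_div,
      integral_add (P.integrable_w _) (P.integrable_w _), P.integral_w, P.integral_w]
    norm_num

/-- The channel that picks the BSC with crossover probability `x_i` with probability `p_i` and
outputs `i` together with the output bit of that BSC. -/
def BMS.ofMasses (l : List (ℝ × ℝ)) (hl : IsMassList l) : BMS where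
  Y := Fin l.length × Bool
  ν := Measure.count
  w x y := (l.get y.1).1 * if y.2 = x then 1 - (l.get y.1).2 else (l.get y.1).2
  measurable_w x := measurable_of_finite _
  w_nonneg x y := by
    obtain ⟨h1, h2, h3⟩ := hl.1 _ (l.get_mem y.1)
    refine mul_nonneg h1.le ?_
    split_ifs <;> linarith
  integral_w x := by
    rw [integral_count, Fintype.sum_prod_type]
    have : ∀ i : Fin l.length, ∑ c : Bool, (l.get i).1 *
        (if c = x then 1 - (l.get i).2 else (l.get i).2) = (l.get i).1 := fun i => by
      cases x <;> simp <;> ring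
    simp only [this]
    rw [← hl.2, ← List.sum_ofFn]
    congr 1
    conv_rhs => rw [← List.ofFn_get l, List.map_ofFn]
    rfl
  π := fun y => (y.1, !y.2)
  π_invol := fun y => by simp
  π_preserving := by
    have hinv : Function.Involutive fun y : Fin l.length × Bool => (y.1, !y.2) :=
      fun y => by simp
    refine ⟨measurable_of_finite _, ?_⟩
    ext s hs
    rw [Measure.map_apply (measurable_of_finite _) hs, ← hinv.image_eq_preimage_symm,
      Measure.count_injective_image hinv.injective]
  w_symm x y := by
    cases x <;> cases h : y.2 <;> simp

/-! ### The greedy mass algorithms -/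

/-- The two greedy algorithms. -/
inductive MassAlgorithm
  | transportation
  | merging

/-- The centre of mass of two masses. -/
def massCentre (a b : ℝ × ℝ) : ℝ :=
  a.1 / (a.1 + b.1) * a.2 + b.1 / (a.1 + b.1) * b.2

/-- The price, measured by `f`, of joining the neighbouring masses `a = (p_i, x_i)` and
`b = (p_{i+1}, x_{i+1})`. -/
def MassAlgorithm.cost (A : MassAlgorithm) (f : ℝ → ℝ) (a b : ℝ × ℝ) : ℝ :=
  match A with
  | .transportation => a.1 * (f b.2 - f a.2)
  | .merging => a.1 * (f (massCentre a b) - f a.2) - b.1 * (f b.2 - f (massCentre a b))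

/-- The mass that replaces the neighbouring masses `a` and `b`. -/
def MassAlgorithm.join (A : MassAlgorithm) (a b : ℝ × ℝ) : ℝ × ℝ :=
  match A with
  | .transportation => (a.1 + b.1, b.2)
  | .merging => (a.1 + b.1, massCentre a b)

/-- The list of the costs of all pairs of neighbours. -/
def MassAlgorithm.costs (A : MassAlgorithm) (f : ℝ → ℝ) : List (ℝ × ℝ) → List ℝ
  | a :: b :: t => A.cost f a b :: A.costs f (b :: t)
  | _ => []

/-- Replace the masses number `j` and `j + 1` (counted from `0`) by their join. -/
def MassAlgorithm.joinAt (A : MassAlgorithm) : ℕ → List (ℝ × ℝ) → List (ℝ × ℝ)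
  | 0, a :: b :: t => A.join a b :: t
  | j + 1, a :: t => a :: A.joinAt j t
  | _, l => l

open Classical in
/-- One step: join the (first) pair of neighbours of least cost. -/
def MassAlgorithm.step (A : MassAlgorithm) (f : ℝ → ℝ) (l : List (ℝ × ℝ)) : List (ℝ × ℝ) :=
  match (List.range (A.costs f l).length).argmin fun j => (A.costs f l).getD j 0 with
  | some j => A.joinAt j l
  | none => l

/-- The greedy algorithm: steps are made until (at most) `k` masses are left. -/
def MassAlgorithm.run (A : MassAlgorithm) (f : ℝ → ℝ) (k : ℕ) (l : List (ℝ × ℝ)) :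
    List (ℝ × ℝ) :=
  (A.step f)^[l.length - k] l

theorem isMassList_joinAt (A : MassAlgorithm) (j : ℕ) (l : List (ℝ × ℝ))
    (h : ∀ a ∈ l, 0 < a.1 ∧ 0 ≤ a.2 ∧ a.2 ≤ 1 / 2) :
    (∀ a ∈ A.joinAt j l, 0 < a.1 ∧ 0 ≤ a.2 ∧ a.2 ≤ 1 / 2) ∧
      ((A.joinAt j l).map Prod.fst).sum = (l.map Prod.fst).sum := by
  fun_induction MassAlgorithm.joinAt A j l with
  | case1 a b t =>
    have ha := h a (by simp)
    have hb := h b (by simp)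
    have hs : 0 < a.1 + b.1 := add_pos ha.1 hb.1
    have hc : massCentre a b = (a.1 * a.2 + b.1 * b.2) / (a.1 + b.1) := by
      unfold massCentre
      ring
    refine ⟨fun c hc' => ?_, by cases A <;> simp [MassAlgorithm.join, add_assoc]⟩
    rcases List.mem_cons.1 hc' with rfl | hc'
    · cases A with
      | transportation => exact ⟨hs, hb.2⟩
      | merging =>
        refine ⟨hs, ?_⟩
        simp only [MassAlgorithm.join, hc]
        constructor
        · exact div_nonneg (add_nonneg (mul_nonneg ha.1.le ha.2.1)
            (mul_nonneg hb.1.le hb.2.1)) hs.le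
        · rw [div_le_iff₀ hs]
          nlinarith [mul_le_mul_of_nonneg_left ha.2.2 ha.1.le,
            mul_le_mul_of_nonneg_left hb.2.2 hb.1.le]
    · exact h c (by simp [hc'])
  | case2 j a t ih =>
    have ih' := ih fun c hc => h c (by simp [hc])
    refine ⟨fun c hc => ?_, by simp [ih'.2]⟩
    rcases List.mem_cons.1 hc with rfl | hc
    · exact h _ (by simp)
    · exact ih'.1 c hc
  | case3 => exact ⟨h, rfl⟩

theorem IsMassList.step {l : List (ℝ × ℝ)} (h : IsMassList l) (A : MassAlgorithm) (f : ℝ → ℝ) :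
    IsMassList (A.step f l) := by
  unfold MassAlgorithm.step
  split
  · rename_i j _
    have := isMassList_joinAt A j l h.1
    exact ⟨this.1, this.2.trans h.2⟩
  · exact h

theorem IsMassList.run {l : List (ℝ × ℝ)} (h : IsMassList l) (A : MassAlgorithm) (f : ℝ → ℝ)
    (k : ℕ) : IsMassList (A.run f k l) := by
  unfold MassAlgorithm.run
  induction l.length - k with
  | zero => exact h
  | succ n ih =>
    rw [Function.iterate_succ_apply']
    exact ih.step A f

/-! ### Quantization procedures -/

/-- `Q` assigns to each channel a channel with at most `k` output symbols. -/
def IsQuantizer (k : ℕ) (Q : BMS → BMS) : Prop :=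
  ∀ P, Finite (Q P).Y ∧ Nat.card (Q P).Y ≤ k

/-- `Q` is admissible: along the polarization tree of every channel, quantization never decreases
the Bhattacharyya parameters. -/
def Admissible (Q : BMS → BMS) : Prop :=
  ∀ (W : BMS) (n i : ℕ), i < 2 ^ n → (W.sub n i).Z ≤ (BMS.quantSub Q W n i).Z

/-- `Q` replaces every channel `P` with `Z(P) < δ` by the erasure channel `BEC(Z(P))`, and every
other channel with finite output alphabet by the output of the mass algorithm `A` (with cost
function `f`), run down to `⌊k/2⌋` masses.  As a mass is a BSC, which has two output symbols,
`⌊k/2⌋` masses amount to at most `k` output symbols. -/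
def IsMassBECScheme (A : MassAlgorithm) (f : ℝ → ℝ) (δ : ℝ) (k : ℕ) (Q : BMS → BMS) : Prop :=
  ∀ P : BMS,
    (P.Z < δ → Q P = BMS.bec P.Z P.Z_nonneg P.Z_le_one) ∧
    (δ ≤ P.Z → ∀ _ : Finite P.Y,
      Q P = BMS.ofMasses (A.run f (k / 2) P.masses) (P.isMassList_masses.run A f (k / 2)))

open Classical in
/-- `ρ = ρ(Q, W)`: the limit exists and equals `ρ`. -/
def IsGoodFraction (Q : BMS → BMS) (W : BMS) (ρ : ℝ) : Prop :=
  Tendsto (fun n : ℕ =>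
      (((Finset.range (2 ^ n)).filter fun i => 1 / 2 < (BMS.quantSub Q W n i).I).card : ℝ) / 2 ^ n)
    atTop (𝓝 ρ)

end

/-! The proof follows the total variation distance `T(P) = ∫ |P(y|0) - P(y|1)| / 2` through the
quantized tree. It satisfies `T(P⁻) = T(P)²` and `T(P⁻) + T(P⁺) ≤ 2 T(P)`, and the scheme never
increases it: the mass algorithms degrade the channel, and `T(BEC(Z(P))) = 1 - Z(P) ≤ T(P)`. Hence
the level averages `S n` of `T` decrease to a limit `ρ`, and the averages of the defect `(T (1 -
T))²` have total sum at most `2`, whatever the tree (`IsPolarizing.sum_defect_le`). Where the defect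
is small, `T` is close to `I` and to the indicator of `I > 1/2`, so `ρ` is also the limiting
fraction of good channels.

The value of `ρ` is read off at one level `n`. Erasure channels have at most two masses, so they
pass through the scheme with `T` unchanged, and for them `T(P⁻) + T(P⁺) = 2 T(P)`. Their
contribution `B n` to `S n` therefore increases with `n`, and `B n ≤ ρ ≤ S n`. A node that is not an
erasure channel has `Z ≥ δ`, which keeps `T` away from `1`; so `S n - B n` is small when the defect
is. By pigeonhole such a level occurs below some `N` that depends on `ε` and `δ` but not on `k`. Now
let `k` exceed all alphabet sizes up to level `N`. No masses are joined there, and capacity is lost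
only when a path first meets an erasure channel, at a price below `δ`. Thus the average of `I` at
level `n` is close to `I(W)`, and so is `ρ`.

Admissibility uses degradation as long as only mass steps have occurred. Past the first erasure
channel only the inequality of the `Z`'s remains, and it is inherited because erasure channels
maximize `Z(P⁻)` for given `Z(P)`. -/

noncomputable section

/-! ### Concave homogeneous functionals of a channel -/

/-- A concave, positively homogeneous function on the quadrant `[0, ∞)²` of linear growth. -/
structure IsConcaveHomog (Φ : ℝ → ℝ → ℝ) : Prop where
  meas : Measurable fun p : ℝ × ℝ => Φ p.1 p.2
  homog : ∀ r a b, 0 ≤ r → 0 ≤ a → 0 ≤ b → Φ (r * a) (r * b) = r * Φ a b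
  superadd : ∀ a b a' b', 0 ≤ a → 0 ≤ b → 0 ≤ a' → 0 ≤ b' →
    Φ a b + Φ a' b' ≤ Φ (a + a') (b + b')
  bound : ∃ C, ∀ a b, 0 ≤ a → 0 ≤ b → |Φ a b| ≤ C * (a + b)

namespace IsConcaveHomog

variable {Φ : ℝ → ℝ → ℝ}

theorem comp_measurable (h : IsConcaveHomog Φ) {α : Type*} [MeasurableSpace α] {u v : α → ℝ}
    (hu : Measurable u) (hv : Measurable v) : Measurable fun x => Φ (u x) (v x) :=
  h.meas.comp (hu.prodMk hv)

theorem nonneg_bound (h : IsConcaveHomog Φ) :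
    ∃ C, 0 ≤ C ∧ ∀ a b, 0 ≤ a → 0 ≤ b → |Φ a b| ≤ C * (a + b) := by
  obtain ⟨C, hC⟩ := h.bound
  refine ⟨|C|, abs_nonneg _, fun a b ha hb => (hC a b ha hb).trans ?_⟩
  exact mul_le_mul_of_nonneg_right (le_abs_self _) (add_nonneg ha hb)

theorem swap (h : IsConcaveHomog Φ) : IsConcaveHomog fun a b => Φ b a where
  meas := h.comp_measurable measurable_snd measurable_fst
  homog r a b hr ha hb := h.homog r b a hr hb ha
  superadd a b a' b' ha hb ha' hb' := h.superadd b a b' a' hb ha hb' ha'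
  bound := by
    obtain ⟨C, hC⟩ := h.bound
    exact ⟨C, fun a b ha hb => by rw [add_comm a b]; exact hC b a hb ha⟩

theorem add {Ψ : ℝ → ℝ → ℝ} (h : IsConcaveHomog Φ) (h' : IsConcaveHomog Ψ) :
    IsConcaveHomog fun a b => Φ a b + Ψ a b where
  meas := h.meas.add h'.meas
  homog r a b hr ha hb := by rw [h.homog r a b hr ha hb, h'.homog r a b hr ha hb, mul_add]
  superadd a b a' b' ha hb ha' hb' := by
    have := h.superadd a b a' b' ha hb ha' hb'
    have := h'.superadd a b a' b' ha hb ha' hb'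
    linarith
  bound := by
    obtain ⟨C, hC⟩ := h.bound
    obtain ⟨D, hD⟩ := h'.bound
    refine ⟨C + D, fun a b ha hb => (abs_add_le _ _).trans ?_⟩
    rw [add_mul]
    exact add_le_add (hC a b ha hb) (hD a b ha hb)

/-- Precomposition with a nonnegative linear map. -/
theorem comp_linear (h : IsConcaveHomog Φ) {p q r s : ℝ} (hp : 0 ≤ p) (hq : 0 ≤ q) (hr : 0 ≤ r)
    (hs : 0 ≤ s) : IsConcaveHomog fun a b => Φ (p * a + q * b) (r * a + s * b) where
  meas := h.comp_measurable (by fun_prop) (by fun_prop)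
  homog t a b ht ha hb := by
    rw [← h.homog t _ _ ht (by positivity) (by positivity)]
    congr 1 <;> ring
  superadd a b a' b' ha hb ha' hb' := by
    refine (h.superadd _ _ _ _ (by positivity) (by positivity) (by positivity)
      (by positivity)).trans_eq ?_
    congr 1 <;> ring
  bound := by
    obtain ⟨C, hC0, hC⟩ := h.nonneg_bound
    refine ⟨C * (p + q + r + s), fun a b ha hb =>
      (hC _ _ (by positivity) (by positivity)).trans ?_⟩
    rw [mul_assoc]
    refine mul_le_mul_of_nonneg_left ?_ hC0
    nlinarith [mul_nonneg hp hb, mul_nonneg hq ha, mul_nonneg hr hb, mul_nonneg hs ha]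

end IsConcaveHomog

/-! ### Degradation and its stability under the two transforms -/

namespace BMS

/-- The integral of `Φ(P(y|0), P(y|1))` over the output alphabet. -/
def avg (P : BMS) (Φ : ℝ → ℝ → ℝ) : ℝ := ∫ y, Φ (P.w false y) (P.w true y) ∂P.ν

/-- `Q` is a degraded version of `P`, tested on all concave homogeneous functions. -/
def Degrades (P Q : BMS) : Prop := ∀ Φ, IsConcaveHomog Φ → P.avg Φ ≤ Q.avg Φ

theorem Degrades.refl (P : BMS) : Degrades P P := fun _ _ => le_rfl

theorem Degrades.trans {P Q R : BMS} (h : Degrades P Q) (h' : Degrades Q R) : Degrades P R :=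
  fun Φ hΦ => (h Φ hΦ).trans (h' Φ hΦ)

theorem integrable_avg_of_bound (P : BMS) {Φ : ℝ → ℝ → ℝ}
    (hm : Measurable fun p : ℝ × ℝ => Φ p.1 p.2) {C : ℝ}
    (hC : ∀ a b, 0 ≤ a → 0 ≤ b → |Φ a b| ≤ C * (a + b)) :
    Integrable (fun y => Φ (P.w false y) (P.w true y)) P.ν := by
  refine Integrable.mono' (((P.integrable_w false).add (P.integrable_w true)).const_mul C) ?_
    (Eventually.of_forall fun y => ?_)
  · exact (hm.comp ((P.measurable_w _).prodMk (P.measurable_w _))).aestronglyMeasurable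
  · exact hC _ _ (P.w_nonneg _ _) (P.w_nonneg _ _)

theorem integrable_avg (P : BMS) {Φ : ℝ → ℝ → ℝ} (h : IsConcaveHomog Φ) :
    Integrable (fun y => Φ (P.w false y) (P.w true y)) P.ν := by
  obtain ⟨C, hC⟩ := h.bound
  exact P.integrable_avg_of_bound h.meas hC

/-- The involution `π` preserves `ν` and exchanges the two densities. This lets every functional be
symmetrized. -/
theorem avg_swap (P : BMS) (Φ : ℝ → ℝ → ℝ) : P.avg (fun a b => Φ b a) = P.avg Φ := by
  have h := P.π_preserving.integral_comp'
    (f := ⟨⟨P.π, P.π, P.π_invol, P.π_invol⟩, P.π_preserving.measurable, P.π_preserving.measurable⟩)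
    (fun y => Φ (P.w false y) (P.w true y))
  unfold avg
  rw [← h]
  refine integral_congr_ae (Eventually.of_forall fun y => ?_)
  have h0 := P.w_symm true y
  have h1 := P.w_symm false y
  simp only [Bool.not_true, Bool.not_false] at h0 h1
  simp only [MeasurableEquiv.coe_mk]
  rw [h0, h1]
  rfl

theorem avg_mono (P : BMS) {Φ Ψ : ℝ → ℝ → ℝ}
    (hΦ : Integrable (fun y => Φ (P.w false y) (P.w true y)) P.ν)
    (hΨ : Integrable (fun y => Ψ (P.w false y) (P.w true y)) P.ν)
    (h : ∀ a b, 0 ≤ a → 0 ≤ b → Φ a b ≤ Ψ a b) : P.avg Φ ≤ P.avg Ψ :=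
  integral_mono hΦ hΨ fun _ => h _ _ (P.w_nonneg _ _) (P.w_nonneg _ _)

/-! ### The two transforms -/

theorem minus_w_false (P : BMS) (y : P.Y × P.Y) : P.minus.w false y =
    1 / 2 * (P.w false y.1 * P.w false y.2 + P.w true y.1 * P.w true y.2) := by
  simp only [minus, Fintype.sum_bool, Bool.false_xor]
  ring

theorem minus_w_true (P : BMS) (y : P.Y × P.Y) : P.minus.w true y =
    1 / 2 * (P.w true y.1 * P.w false y.2 + P.w false y.1 * P.w true y.2) := by
  simp only [minus, Fintype.sum_bool, Bool.true_xor, Bool.not_true, Bool.not_false]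
  ring

theorem avg_minus (P : BMS) (Φ : ℝ → ℝ → ℝ) : P.minus.avg Φ = ∫ z : P.Y × P.Y,
    Φ (1 / 2 * (P.w false z.1 * P.w false z.2 + P.w true z.1 * P.w true z.2))
      (1 / 2 * (P.w true z.1 * P.w false z.2 + P.w false z.1 * P.w true z.2)) ∂P.ν.prod P.ν :=
  integral_congr_ae (Eventually.of_forall fun z =>
    congrArg₂ Φ (P.minus_w_false z) (P.minus_w_true z))

/-- The two summands belong to `x₁ = 1` and `x₁ = 0`. Integrability is what Fubini needs to sum out
the Boolean coordinate first. -/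
theorem avg_plus (P : BMS) {Φ : ℝ → ℝ → ℝ}
    (h : Integrable (fun y => Φ (P.plus.w false y) (P.plus.w true y)) P.plus.ν) :
    P.plus.avg Φ = ∫ z : P.Y × P.Y,
      (Φ (1 / 2 * (P.w true z.1 * P.w false z.2)) (1 / 2 * (P.w false z.1 * P.w true z.2)) +
        Φ (1 / 2 * (P.w false z.1 * P.w false z.2)) (1 / 2 * (P.w true z.1 * P.w true z.2)))
        ∂P.ν.prod P.ν := by
  have hmp : MeasurePreserving (MeasurableEquiv.prodAssoc : (P.Y × P.Y) × Bool ≃ᵐ _)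
      ((P.ν.prod P.ν).prod Measure.count) (P.ν.prod (P.ν.prod Measure.count)) :=
    measurePreserving_prodAssoc _ _ _
  have h2 := (hmp.integrable_comp_emb (MeasurableEquiv.measurableEmbedding _)).2 h
  have h1 := hmp.integral_comp' (fun y => Φ (P.plus.w false y) (P.plus.w true y))
  unfold avg
  refine h1.symm.trans ?_
  refine (integral_prod _ h2).trans ?_
  refine integral_congr_ae (Eventually.of_forall fun z => ?_)
  simp only [integral_count, Fintype.sum_bool]
  simp [plus, MeasurableEquiv.prodAssoc, Function.comp, mul_assoc]

/-- Both transforms integrate a kernel over two independent outputs. The channel is exchanged in one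
coordinate at a time: with the other coordinate frozen the kernel is an admissible test function.
The bound on `G` serves Fubini. -/
theorem integral_prod_mono_of_degrades {P Q : BMS} (hPQ : Degrades P Q)
    {G : ℝ → ℝ → ℝ → ℝ → ℝ} (hm : Measurable fun p : (ℝ × ℝ) × ℝ × ℝ => G p.1.1 p.1.2 p.2.1 p.2.2)
    {C : ℝ} (hC : ∀ a b c d, 0 ≤ a → 0 ≤ b → 0 ≤ c → 0 ≤ d →
      |G a b c d| ≤ C * ((a + b) * (c + d)))
    (h₁ : ∀ c d, 0 ≤ c → 0 ≤ d → IsConcaveHomog fun a b => G a b c d)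
    (h₂ : ∀ a b, 0 ≤ a → 0 ≤ b → IsConcaveHomog fun c d => G a b c d) :
    ∫ z : P.Y × P.Y, G (P.w false z.1) (P.w true z.1) (P.w false z.2) (P.w true z.2)
        ∂P.ν.prod P.ν ≤
      ∫ z : Q.Y × Q.Y, G (Q.w false z.1) (Q.w true z.1) (Q.w false z.2) (Q.w true z.2)
        ∂Q.ν.prod Q.ν := by
  have hG : ∀ R S : BMS, Integrable (fun z : R.Y × S.Y =>
      G (R.w false z.1) (R.w true z.1) (S.w false z.2) (S.w true z.2)) (R.ν.prod S.ν) := by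
    intro R S
    refine Integrable.mono' ((Integrable.mul_prod
      ((R.integrable_w false).add (R.integrable_w true))
      ((S.integrable_w false).add (S.integrable_w true))).const_mul C) ?_
      (Eventually.of_forall fun z => ?_)
    · refine (hm.comp (Measurable.prodMk (Measurable.prodMk ?_ ?_)
        (Measurable.prodMk ?_ ?_))).aestronglyMeasurable
      · exact (R.measurable_w _).comp measurable_fst
      · exact (R.measurable_w _).comp measurable_fst
      · exact (S.measurable_w _).comp measurable_snd
      · exact (S.measurable_w _).comp measurable_snd
    · exact hC _ _ _ _ (R.w_nonneg _ _) (R.w_nonneg _ _) (S.w_nonneg _ _) (S.w_nonneg _ _)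
  calc _ = ∫ x, ∫ y, G (P.w false x) (P.w true x) (P.w false y) (P.w true y) ∂P.ν ∂P.ν :=
        integral_prod _ (hG P P)
    _ ≤ ∫ x, ∫ y, G (P.w false x) (P.w true x) (Q.w false y) (Q.w true y) ∂Q.ν ∂P.ν :=
        integral_mono (hG P P).integral_prod_left (hG P Q).integral_prod_left fun x =>
          hPQ _ (h₂ _ _ (P.w_nonneg _ _) (P.w_nonneg _ _))
    _ = ∫ z : P.Y × Q.Y, G (P.w false z.1) (P.w true z.1) (Q.w false z.2) (Q.w true z.2)
        ∂P.ν.prod Q.ν := (integral_prod _ (hG P Q)).symm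
    _ = ∫ y, ∫ x, G (P.w false x) (P.w true x) (Q.w false y) (Q.w true y) ∂P.ν ∂Q.ν :=
        integral_prod_symm _ (hG P Q)
    _ ≤ ∫ y, ∫ x, G (Q.w false x) (Q.w true x) (Q.w false y) (Q.w true y) ∂Q.ν ∂Q.ν :=
        integral_mono (hG P Q).integral_prod_right (hG Q Q).integral_prod_right fun y =>
          hPQ _ (h₁ _ _ (Q.w_nonneg _ _) (Q.w_nonneg _ _))
    _ = _ := (integral_prod_symm _ (hG Q Q)).symm

theorem Degrades.minus {P Q : BMS} (h : Degrades P Q) : Degrades P.minus Q.minus := by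
  intro Φ hΦ
  obtain ⟨C, hC0, hC⟩ := hΦ.nonneg_bound
  rw [avg_minus, avg_minus]
  refine integral_prod_mono_of_degrades h
    (G := fun a b c d => Φ (1 / 2 * (a * c + b * d)) (1 / 2 * (b * c + a * d))) (C := C)
    (hΦ.comp_measurable (by fun_prop) (by fun_prop)) ?_ ?_ ?_
  · intro a b c d ha hb hc hd
    refine (hC _ _ (by positivity) (by positivity)).trans (mul_le_mul_of_nonneg_left ?_ hC0)
    nlinarith [mul_nonneg (add_nonneg ha hb) (add_nonneg hc hd)]
  · intro c d hc hd
    convert hΦ.comp_linear (p := c / 2) (q := d / 2) (r := d / 2) (s := c / 2) (by positivity)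
      (by positivity) (by positivity) (by positivity) using 4 <;> ring
  · intro a b ha hb
    convert hΦ.comp_linear (p := a / 2) (q := b / 2) (r := b / 2) (s := a / 2) (by positivity)
      (by positivity) (by positivity) (by positivity) using 4 <;> ring

theorem Degrades.plus {P Q : BMS} (h : Degrades P Q) : Degrades P.plus Q.plus := by
  intro Φ hΦ
  obtain ⟨C, hC0, hC⟩ := hΦ.nonneg_bound
  rw [avg_plus P (integrable_avg _ hΦ), avg_plus Q (integrable_avg _ hΦ)]
  refine integral_prod_mono_of_degrades h
    (G := fun a b c d => Φ (1 / 2 * (b * c)) (1 / 2 * (a * d)) +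
      Φ (1 / 2 * (a * c)) (1 / 2 * (b * d))) (C := C)
    ((hΦ.comp_measurable (by fun_prop) (by fun_prop)).add
      (hΦ.comp_measurable (by fun_prop) (by fun_prop))) ?_ ?_ ?_
  · intro a b c d ha hb hc hd
    refine (abs_add_le _ _).trans ((add_le_add (hC _ _ (by positivity) (by positivity))
      (hC _ _ (by positivity) (by positivity))).trans ?_)
    rw [← mul_add]
    refine mul_le_mul_of_nonneg_left ?_ hC0
    nlinarith [mul_nonneg (add_nonneg ha hb) (add_nonneg hc hd)]
  · intro c d hc hd
    convert (hΦ.comp_linear (p := 0) (q := c / 2) (r := d / 2) (s := 0) le_rfl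
      (by positivity) (by positivity) le_rfl).add (hΦ.comp_linear (p := c / 2) (q := 0) (r := 0)
      (s := d / 2) (by positivity) le_rfl le_rfl (by positivity)) using 5 <;> ring
  · intro a b ha hb
    convert (hΦ.comp_linear (p := b / 2) (q := 0) (r := 0) (s := a / 2) (by positivity) le_rfl
      le_rfl (by positivity)).add (hΦ.comp_linear (p := a / 2) (q := 0) (r := 0)
      (s := b / 2) (by positivity) le_rfl le_rfl (by positivity)) using 5 <;> ring

theorem Degrades.child {P Q : BMS} (h : Degrades P Q) (b : Bool) :
    Degrades (P.child b) (Q.child b) := by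
  cases b
  · exact h.minus
  · exact h.plus

end BMS

/-! ### The Bhattacharyya parameter -/

theorem isConcaveHomog_sqrt : IsConcaveHomog fun a b => Real.sqrt (a * b) where
  meas := by fun_prop
  homog r a b hr ha hb := by
    rw [show r * a * (r * b) = r ^ 2 * (a * b) by ring, Real.sqrt_mul (sq_nonneg r),
      Real.sqrt_sq hr]
  superadd a b a' b' ha hb ha' hb' := by
    refine Real.le_sqrt_of_sq_le ?_
    have h1 := Real.sq_sqrt (mul_nonneg ha hb)
    have h2 := Real.sq_sqrt (mul_nonneg ha' hb')
    -- The cross term of the square is controlled by AM-GM applied to `a * b'` and `a' * b`.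
    have h3 : 2 * (Real.sqrt (a * b) * Real.sqrt (a' * b')) ≤ a * b' + a' * b := by
      rw [← Real.sqrt_mul (mul_nonneg ha hb),
        show a * b * (a' * b') = (a * b') * (a' * b) by ring,
        Real.sqrt_mul (mul_nonneg ha hb')]
      nlinarith [sq_nonneg (Real.sqrt (a * b') - Real.sqrt (a' * b)),
        Real.sq_sqrt (mul_nonneg ha hb'), Real.sq_sqrt (mul_nonneg ha' hb)]
    nlinarith
  bound := by
    refine ⟨1, fun a b ha hb => ?_⟩
    rw [abs_of_nonneg (Real.sqrt_nonneg _)]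
    refine Real.sqrt_le_iff.2 ⟨by positivity, ?_⟩
    nlinarith [mul_nonneg ha hb, sq_nonneg a, sq_nonneg b]

theorem isConcaveHomog_neg_abs_sub : IsConcaveHomog fun a b => -(|a - b| / 2) where
  meas := by fun_prop
  homog r a b hr ha hb := by
    rw [← mul_sub, abs_mul, abs_of_nonneg hr]
    ring
  superadd a b a' b' ha hb ha' hb' := by
    have := abs_add_le (a - b) (a' - b')
    rw [show a + a' - (b + b') = a - b + (a' - b') by ring]
    linarith
  bound := by
    refine ⟨1, fun a b ha hb => ?_⟩
    rw [abs_neg, abs_of_nonneg (by positivity)]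
    have : |a - b| ≤ a + b := abs_sub_le_iff.2 ⟨by linarith, by linarith⟩
    linarith [abs_nonneg (a - b)]

namespace BMS

theorem Z_eq_avg (P : BMS) : P.Z = P.avg fun a b => Real.sqrt (a * b) := rfl

/-- The total variation distance between the two output distributions. -/
def T (P : BMS) : ℝ := P.avg fun a b => |a - b| / 2

theorem integrable_T (P : BMS) : Integrable (fun y => |P.w false y - P.w true y| / 2) P.ν :=
  (((P.integrable_w _).sub (P.integrable_w _)).abs).div_const 2

theorem neg_T_eq_avg (P : BMS) : -P.T = P.avg fun a b => -(|a - b| / 2) :=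
  (integral_neg _).symm

theorem Degrades.Z_le {P Q : BMS} (h : Degrades P Q) : P.Z ≤ Q.Z := h _ isConcaveHomog_sqrt

theorem Degrades.T_le {P Q : BMS} (h : Degrades P Q) : Q.T ≤ P.T := by
  have := h _ isConcaveHomog_neg_abs_sub
  rw [← neg_T_eq_avg, ← neg_T_eq_avg] at this
  linarith

theorem integrable_Z (P : BMS) :
    Integrable (fun y => Real.sqrt (P.w false y * P.w true y)) P.ν :=
  P.integrable_avg isConcaveHomog_sqrt

theorem integrable_half_sum (P : BMS) :
    Integrable (fun y => (P.w false y + P.w true y) / 2) P.ν :=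
  ((P.integrable_w _).add (P.integrable_w _)).div_const 2

theorem integral_half_sum (P : BMS) : ∫ y, (P.w false y + P.w true y) / 2 ∂P.ν = 1 := by
  rw [integral_div, integral_add (P.integrable_w _) (P.integrable_w _), P.integral_w,
    P.integral_w]
  norm_num

theorem T_nonneg (P : BMS) : 0 ≤ P.T := integral_nonneg fun _ => by positivity

theorem T_le_one (P : BMS) : P.T ≤ 1 := by
  rw [← P.integral_half_sum]
  refine P.avg_mono (Ψ := fun a b => (a + b) / 2) P.integrable_T P.integrable_half_sum
    fun a b ha hb => ?_
  have : |a - b| ≤ a + b := abs_sub_le_iff.2 ⟨by linarith, by linarith⟩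
  linarith

/-- Pointwise `(√a - √b)² ≤ |√a - √b| (√a + √b) = |a - b|`. This is why replacing `P` by `BEC(Z(P))`
cannot raise `T`. -/
theorem one_sub_Z_le_T (P : BMS) : 1 - P.Z ≤ P.T := by
  rw [← P.integral_half_sum, Z_eq_avg]
  unfold avg
  rw [← integral_sub P.integrable_half_sum P.integrable_Z]
  refine P.avg_mono (Φ := fun a b => (a + b) / 2 - Real.sqrt (a * b))
    (P.integrable_half_sum.sub P.integrable_Z) P.integrable_T fun a b ha hb => ?_
  have h1 := Real.sq_sqrt ha
  have h2 := Real.sq_sqrt hb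
  have ha' := Real.sqrt_nonneg a
  have hb' := Real.sqrt_nonneg b
  rw [Real.sqrt_mul ha]
  rcases le_total b a with hab | hab
  · have := Real.sqrt_le_sqrt hab
    rw [abs_of_nonneg (by linarith)]
    nlinarith
  · have := Real.sqrt_le_sqrt hab
    rw [abs_of_nonpos (by linarith)]
    nlinarith

/-- The plane vector `(√(ab), |a - b| / 2)` has length `(a + b) / 2`, and the length of an integral
is at most the integral of the lengths. The latter is tested against the direction `(Z, T)`. -/
theorem sq_Z_add_sq_T_le_one (P : BMS) : P.Z ^ 2 + P.T ^ 2 ≤ 1 := by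
  set R := Real.sqrt (P.Z ^ 2 + P.T ^ 2) with hR
  have hR2 : R ^ 2 = P.Z ^ 2 + P.T ^ 2 := Real.sq_sqrt (by positivity)
  have hR0 : 0 ≤ R := Real.sqrt_nonneg _
  have key : P.Z * P.Z + P.T * P.T ≤ R * 1 := by
    rw [← P.integral_half_sum, ← integral_const_mul]
    have hi := (P.integrable_Z.const_mul P.Z).add (P.integrable_T.const_mul P.T)
    have e : P.Z * P.Z + P.T * P.T =
        P.avg fun a b => P.Z * Real.sqrt (a * b) + P.T * (|a - b| / 2) := by
      unfold avg
      rw [integral_add (P.integrable_Z.const_mul P.Z) (P.integrable_T.const_mul P.T),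
        integral_const_mul, integral_const_mul]
      rfl
    rw [e]
    refine P.avg_mono (Ψ := fun a b => R * ((a + b) / 2)) hi
      (P.integrable_half_sum.const_mul R) fun a b ha hb => ?_
    refine abs_le_of_sq_le_sq' ?_ (by positivity) |>.2
    have h1 := Real.sq_sqrt (mul_nonneg ha hb)
    have h2 := sq_abs (a - b)
    rw [mul_pow, hR2]
    have h3 : ((a + b) / 2) ^ 2 = Real.sqrt (a * b) ^ 2 + (|a - b| / 2) ^ 2 := by
      rw [div_pow |a - b|, h1, h2]; ring
    rw [h3]
    nlinarith [sq_nonneg (P.Z * (|a - b| / 2) - P.T * Real.sqrt (a * b))]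
  have : R ≤ 1 := by nlinarith
  nlinarith

/-- The difference of the two densities of `P⁻` factors as `(a - b)(c - d) / 2`. -/
theorem T_minus (P : BMS) : P.minus.T = P.T ^ 2 := by
  unfold T
  rw [avg_minus, sq]
  unfold avg
  rw [← integral_prod_mul]
  refine integral_congr_ae (Eventually.of_forall fun z => ?_)
  simp only
  rw [div_mul_div_comm, ← abs_mul, ← mul_sub, abs_mul, abs_of_pos (by norm_num : (0 : ℝ) < 1 / 2),
    show ∀ a b c d : ℝ, a * c + b * d - (b * c + a * d) = (a - b) * (c - d) from
      fun a b c d => by ring]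
  ring

theorem Z_plus (P : BMS) : P.plus.Z = P.Z ^ 2 := by
  rw [Z_eq_avg, avg_plus _ P.plus.integrable_Z, sq]
  unfold Z
  rw [← integral_prod_mul]
  refine integral_congr_ae (Eventually.of_forall fun z => ?_)
  have h0 := mul_nonneg (P.w_nonneg false z.1) (P.w_nonneg true z.1)
  simp only
  rw [← Real.sqrt_mul h0]
  have : ∀ t, Real.sqrt (1 / 2 * (1 / 2) * t) = 1 / 2 * Real.sqrt t := fun t => by
    rw [Real.sqrt_mul (by norm_num), Real.sqrt_mul_self (by norm_num)]
  rw [show ∀ a b c d : ℝ, 1 / 2 * (b * c) * (1 / 2 * (a * d)) = 1 / 2 * (1 / 2) * (a * b * (c * d))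
      from fun a b c d => by ring,
    show ∀ a b c d : ℝ, 1 / 2 * (a * c) * (1 / 2 * (b * d)) = 1 / 2 * (1 / 2) * (a * b * (c * d))
      from fun a b c d => by ring, this]
  ring

theorem integrable_symm_kernel (P : BMS) {u s : P.Y → ℝ} (hu : Integrable u P.ν)
    (hs : Integrable s P.ν) :
    Integrable (fun z : P.Y × P.Y => u z.1 * s z.2 + s z.1 * u z.2) (P.ν.prod P.ν) :=
  (hu.mul_prod hs).add (hs.mul_prod hu)

theorem integral_symm_kernel (P : BMS) {u s : P.Y → ℝ} (hu : Integrable u P.ν)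
    (hs : Integrable s P.ν) :
    ∫ z : P.Y × P.Y, (u z.1 * s z.2 + s z.1 * u z.2) ∂P.ν.prod P.ν =
      2 * ((∫ y, u y ∂P.ν) * ∫ y, s y ∂P.ν) := by
  rw [integral_add (hu.mul_prod hs) (hs.mul_prod hu), integral_prod_mul, integral_prod_mul]
  ring

theorem integral_inclusion_kernel (P : BMS) {u s : P.Y → ℝ} (hu : Integrable u P.ν)
    (hs : Integrable s P.ν) :
    ∫ z : P.Y × P.Y, (u z.1 * s z.2 + s z.1 * u z.2 - u z.1 * u z.2) ∂P.ν.prod P.ν =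
      2 * ((∫ y, u y ∂P.ν) * ∫ y, s y ∂P.ν) - (∫ y, u y ∂P.ν) ^ 2 := by
  rw [integral_sub (P.integrable_symm_kernel hu hs) (hu.mul_prod hu),
    P.integral_symm_kernel hu hs, integral_prod_mul, sq]

theorem Z_minus_le (P : BMS) : P.minus.Z ≤ 2 * P.Z - P.Z ^ 2 := by
  have hZ := P.integrable_Z
  have hs := P.integrable_half_sum
  have e : 2 * P.Z - P.Z ^ 2 = ∫ z : P.Y × P.Y,
      ((Real.sqrt (P.w false z.1 * P.w true z.1) * ((P.w false z.2 + P.w true z.2) / 2) +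
        (P.w false z.1 + P.w true z.1) / 2 * Real.sqrt (P.w false z.2 * P.w true z.2)) -
        Real.sqrt (P.w false z.1 * P.w true z.1) * Real.sqrt (P.w false z.2 * P.w true z.2))
      ∂P.ν.prod P.ν := by
    rw [P.integral_inclusion_kernel hZ hs, P.integral_half_sum, mul_one]
    rfl
  rw [e, Z_eq_avg, avg_minus]
  refine integral_mono_of_nonneg (Eventually.of_forall fun _ => Real.sqrt_nonneg _)
    ((P.integrable_symm_kernel hZ hs).sub (hZ.mul_prod hZ))
    (Eventually.of_forall fun z => ?_)
  have key : ∀ a b c d : ℝ, 0 ≤ a → 0 ≤ b → 0 ≤ c → 0 ≤ d →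
      Real.sqrt (1 / 2 * (a * c + b * d) * (1 / 2 * (b * c + a * d))) ≤
      Real.sqrt (a * b) * ((c + d) / 2) + (a + b) / 2 * Real.sqrt (c * d) -
        Real.sqrt (a * b) * Real.sqrt (c * d) := by
    intro a b c d ha hb hc hd
    have hs := Real.sq_sqrt (mul_nonneg ha hb)
    have ht := Real.sq_sqrt (mul_nonneg hc hd)
    have hs0 := Real.sqrt_nonneg (a * b)
    have ht0 := Real.sqrt_nonneg (c * d)
    set s := Real.sqrt (a * b)
    set t := Real.sqrt (c * d)
    have h1 : 2 * s ≤ a + b := by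
      refine abs_le_of_sq_le_sq' ?_ (by positivity) |>.2
      nlinarith [sq_nonneg (a - b)]
    have h2 : 2 * t ≤ c + d := by
      refine abs_le_of_sq_le_sq' ?_ (by positivity) |>.2
      nlinarith [sq_nonneg (c - d)]
    refine Real.sqrt_le_iff.2 ⟨?_, ?_⟩
    · nlinarith [mul_nonneg hs0 (sub_nonneg.2 h2), mul_nonneg ht0 (sub_nonneg.2 h1)]
    · have e1 : 1 / 2 * (a * c + b * d) * (1 / 2 * (b * c + a * d)) =
          1 / 4 * (s ^ 2 * (c + d) ^ 2 + t ^ 2 * (a + b) ^ 2 - 4 * (s ^ 2 * t ^ 2)) := by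
        rw [hs, ht]; ring
      rw [e1]
      -- The difference of the squares is `2st (A - s)(D - t)` with `A = (a + b) / 2` and `D = (c +
      -- d) / 2`.
      nlinarith [mul_nonneg (mul_nonneg hs0 ht0) (mul_nonneg (sub_nonneg.2 h1) (sub_nonneg.2 h2))]
  exact key _ _ _ _ (P.w_nonneg _ _) (P.w_nonneg _ _) (P.w_nonneg _ _) (P.w_nonneg _ _)

/-- It suffices that `T(P⁺) ≤ 2T - T²`. Pointwise, `|x| + |y| = max |x + y| |x - y|` turns the left
side into the larger of `(a + b)|c - d| / 4` and `|a - b|(c + d) / 4`, and `|a - b| ≤ a + b`, `|c -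
d| ≤ c + d` give the rest. -/
theorem T_minus_add_T_plus_le (P : BMS) : P.minus.T + P.plus.T ≤ 2 * P.T := by
  have hT := P.integrable_T
  have hs := P.integrable_half_sum
  have e : 2 * P.T - P.T ^ 2 = ∫ z : P.Y × P.Y,
      (|P.w false z.1 - P.w true z.1| / 2 * ((P.w false z.2 + P.w true z.2) / 2) +
        (P.w false z.1 + P.w true z.1) / 2 * (|P.w false z.2 - P.w true z.2| / 2) -
        |P.w false z.1 - P.w true z.1| / 2 * (|P.w false z.2 - P.w true z.2| / 2))
      ∂P.ν.prod P.ν := by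
    rw [P.integral_inclusion_kernel hT hs, P.integral_half_sum, mul_one]
    rfl
  rw [T_minus]
  suffices h : P.plus.T ≤ 2 * P.T - P.T ^ 2 by linarith
  rw [e]
  unfold T
  rw [avg_plus _ P.plus.integrable_T]
  refine integral_mono_of_nonneg (Eventually.of_forall fun _ => by positivity)
    ((P.integrable_symm_kernel hT hs).sub (hT.mul_prod hT))
    (Eventually.of_forall fun z => ?_)
  have key : ∀ a b c d : ℝ, 0 ≤ a → 0 ≤ b → 0 ≤ c → 0 ≤ d →
      |1 / 2 * (b * c) - 1 / 2 * (a * d)| / 2 + |1 / 2 * (a * c) - 1 / 2 * (b * d)| / 2 ≤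
      |a - b| / 2 * ((c + d) / 2) + (a + b) / 2 * (|c - d| / 2) -
        |a - b| / 2 * (|c - d| / 2) := by
    intro a b c d ha hb hc hd
    have h1 : |a - b| ≤ a + b := abs_sub_le_iff.2 ⟨by linarith, by linarith⟩
    have h2 : |c - d| ≤ c + d := abs_sub_le_iff.2 ⟨by linarith, by linarith⟩
    have h3 := mul_nonneg (abs_nonneg (a - b)) (sub_nonneg.2 h2)
    have h4 := mul_nonneg (sub_nonneg.2 h1) (abs_nonneg (c - d))
    have h5 := mul_le_mul_of_nonneg_right (le_abs_self (a - b)) (add_nonneg hc hd)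
    have h6 := mul_le_mul_of_nonneg_right (neg_abs_le (a - b)) (add_nonneg hc hd)
    have h7 := mul_le_mul_of_nonneg_left (le_abs_self (c - d)) (add_nonneg ha hb)
    have h8 := mul_le_mul_of_nonneg_left (neg_abs_le (c - d)) (add_nonneg ha hb)
    rcases abs_cases (1 / 2 * (b * c) - 1 / 2 * (a * d)) with ⟨e1, _⟩ | ⟨e1, _⟩ <;>
    rcases abs_cases (1 / 2 * (a * c) - 1 / 2 * (b * d)) with ⟨e2, _⟩ | ⟨e2, _⟩ <;>
    rw [e1, e2] <;> nlinarith
  exact key _ _ _ _ (P.w_nonneg _ _) (P.w_nonneg _ _) (P.w_nonneg _ _) (P.w_nonneg _ _)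

end BMS

/-! ### The symmetric capacity -/

/-- The integrand of the symmetric capacity. -/
def capacityDensity (a b : ℝ) : ℝ :=
  1 / 2 * a * Real.logb 2 (a / (1 / 2 * a + 1 / 2 * b)) +
    1 / 2 * b * Real.logb 2 (b / (1 / 2 * a + 1 / 2 * b))

/-- Without quotients inside the logarithm, and with `0 * log 0 = 0`, the chain rule below becomes
algebra. -/
theorem capacityDensity_eq_log {a b : ℝ} (ha : 0 ≤ a) (hb : 0 ≤ b) :
    capacityDensity a b = (a * Real.log a + b * Real.log b - (a + b) * Real.log (a + b) +
      (a + b) * Real.log 2) / (2 * Real.log 2) := by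
  have hl : Real.log 2 ≠ 0 := (Real.log_pos one_lt_two).ne'
  have key : ∀ c s : ℝ, 0 ≤ c → c ≤ s → 1 / 2 * c * Real.logb 2 (c / (s / 2)) =
      (c * Real.log c - c * Real.log s + c * Real.log 2) / (2 * Real.log 2) := by
    intro c s hc hs
    rcases hc.eq_or_lt with rfl | hc
    · simp
    · have hs0 : 0 < s := hc.trans_le hs
      rw [Real.logb, Real.log_div hc.ne' (by positivity), Real.log_div hs0.ne' two_ne_zero]
      field_simp
      ring
  unfold capacityDensity
  rw [show 1 / 2 * a + 1 / 2 * b = (a + b) / 2 by ring, key a (a + b) ha (by linarith),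
    key b (a + b) hb (by linarith)]
  ring

theorem capacityDensity_eq_binEntropy {a b : ℝ} (ha : 0 ≤ a) (hb : 0 ≤ b) :
    capacityDensity a b =
      (a + b) / 2 - (a + b) / (2 * Real.log 2) * Real.binEntropy (b / (a + b)) := by
  have hl : Real.log 2 ≠ 0 := (Real.log_pos one_lt_two).ne'
  rcases (add_nonneg ha hb).eq_or_lt with h | h
  · have ha0 : a = 0 := by linarith
    have hb0 : b = 0 := by linarith
    simp [ha0, hb0, capacityDensity]
  · rw [capacityDensity_eq_log ha hb, Real.binEntropy_eq_negMulLog_add_negMulLog_one_sub]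
    have e : 1 - b / (a + b) = a / (a + b) := by field_simp; ring
    have key : ∀ c : ℝ, 0 ≤ c → (a + b) * Real.negMulLog (c / (a + b)) =
        c * Real.log (a + b) - c * Real.log c := by
      intro c hc
      rcases hc.eq_or_lt with rfl | hc
      · simp
      · rw [Real.negMulLog, Real.log_div hc.ne' h.ne']
        field_simp
        ring
    have h1 := key a ha
    have h2 := key b hb
    rw [e, div_mul_eq_mul_div, mul_add, h1, h2]
    field_simp
    ring

/-- With `u = √p` and `v = √(1 - p)`, Jensen for the logarithm bounds the entropy by `2 log (u +
v)`, the Rényi entropy of order `1/2`. This equals `log (1 + 2uv) ≤ 2uv`. -/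
theorem Real.binEntropy_le_two_mul_sqrt {p : ℝ} (h0 : 0 ≤ p) (h1 : p ≤ 1) :
    Real.binEntropy p ≤ 2 * Real.sqrt (p * (1 - p)) := by
  have hq : 0 ≤ 1 - p := by linarith
  set u := Real.sqrt p with hu
  set v := Real.sqrt (1 - p) with hv
  have hu2 : u ^ 2 = p := Real.sq_sqrt h0
  have hv2 : v ^ 2 = 1 - p := Real.sq_sqrt hq
  have hu0 : 0 ≤ u := Real.sqrt_nonneg _
  have hv0 : 0 ≤ v := Real.sqrt_nonneg _
  have hs : 0 < u + v := by
    by_contra h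
    have : u = 0 := by linarith
    have : v = 0 := by linarith
    nlinarith
  -- Jensen by hand: `log x ≤ x - 1` at `x = 1 / (t (u + v))`, weighted with `2t²`. The error terms
  -- for `u` and `v` cancel because `u² + v² = 1`.
  have key : ∀ t : ℝ, 0 ≤ t → Real.negMulLog (t ^ 2) ≤
      2 * t ^ 2 * Real.log (u + v) + 2 * (t / (u + v) - t ^ 2) := by
    intro t ht
    rcases ht.eq_or_lt with rfl | ht
    · simp
    · have h := Real.log_le_sub_one_of_pos (show 0 < 1 / (t * (u + v)) by positivity)
      rw [one_div, Real.log_inv, Real.log_mul ht.ne' hs.ne'] at h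
      have h' := mul_le_mul_of_nonneg_left h (show 0 ≤ 2 * t ^ 2 by positivity)
      have e : 2 * t ^ 2 * ((t * (u + v))⁻¹ - 1) = 2 * (t / (u + v) - t ^ 2) := by
        field_simp
      rw [e] at h'
      rw [Real.negMulLog, Real.log_pow]
      push_cast
      linarith
  have hsum : Real.binEntropy p ≤ 2 * Real.log (u + v) := by
    rw [Real.binEntropy_eq_negMulLog_add_negMulLog_one_sub, ← hv2, ← hu2]
    have k1 := key u hu0
    have k2 := key v hv0
    have e : u / (u + v) + v / (u + v) = 1 := by field_simp
    have e' : 2 * u ^ 2 * Real.log (u + v) + 2 * v ^ 2 * Real.log (u + v) =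
        2 * Real.log (u + v) := by
      rw [hu2, hv2]
      ring
    linarith
  refine hsum.trans ?_
  have h2 : 2 * Real.log (u + v) = Real.log ((u + v) ^ 2) := by rw [Real.log_pow]; push_cast; ring
  have h3 := Real.log_le_sub_one_of_pos (show 0 < (u + v) ^ 2 by positivity)
  rw [h2, Real.sqrt_mul h0, ← hu, ← hv]
  nlinarith

/-- A concave function lies above its chord, here from `0` to `1/2`; the other half follows by
reflection. -/
theorem Real.mul_log_two_le_binEntropy {p : ℝ} (h0 : 0 ≤ p) (h1 : p ≤ 1) :
    (1 - |1 - 2 * p|) * Real.log 2 ≤ Real.binEntropy p := by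
  have main : ∀ q : ℝ, 0 ≤ q → q ≤ 1 / 2 → 2 * q * Real.log 2 ≤ Real.binEntropy q := by
    intro q hq0 hq1
    have h := Real.strictConcave_binEntropy.concaveOn.2 (x := 0) (y := 2⁻¹) (by simp)
      (by norm_num) (show 0 ≤ 1 - 2 * q by linarith) (show 0 ≤ 2 * q by linarith) (by ring)
    simp only [smul_eq_mul, Real.binEntropy_zero, Real.binEntropy_two_inv, mul_zero,
      zero_add] at h
    rwa [show 2 * q * 2⁻¹ = q by ring] at h
  rcases le_total p (1 / 2) with h | h
  · rw [abs_of_nonneg (by linarith)]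
    simpa using main p h0 h
  · rw [abs_of_nonpos (by linarith), ← Real.binEntropy_one_sub]
    have := main (1 - p) (by linarith) (by linarith)
    linarith

theorem capacityDensity_nonneg {a b : ℝ} (ha : 0 ≤ a) (hb : 0 ≤ b) : 0 ≤ capacityDensity a b := by
  have hl : 0 < Real.log 2 := Real.log_pos one_lt_two
  rw [capacityDensity_eq_binEntropy ha hb]
  have := mul_le_mul_of_nonneg_left (Real.binEntropy_le_log_two (p := b / (a + b)))
    (show 0 ≤ (a + b) / (2 * Real.log 2) by positivity)
  have e : (a + b) / (2 * Real.log 2) * Real.log 2 = (a + b) / 2 := by field_simp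
  linarith

theorem capacityDensity_le {a b : ℝ} (ha : 0 ≤ a) (hb : 0 ≤ b) :
    capacityDensity a b ≤ |a - b| / 2 := by
  have hl : 0 < Real.log 2 := Real.log_pos one_lt_two
  rw [capacityDensity_eq_binEntropy ha hb]
  rcases (add_nonneg ha hb).eq_or_lt with h | h
  · rw [← h]
    simp only [zero_div, zero_mul, sub_zero]
    positivity
  have h1 := mul_le_mul_of_nonneg_left (Real.mul_log_two_le_binEntropy (p := b / (a + b))
    (by positivity) (by rw [div_le_one h]; linarith))
    (show 0 ≤ (a + b) / (2 * Real.log 2) by positivity)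
  have e : |1 - 2 * (b / (a + b))| = |a - b| / (a + b) := by
    rw [← abs_of_pos h, ← abs_div, abs_of_pos h]
    congr 1
    field_simp
    ring
  have e2 : (a + b) / (2 * Real.log 2) * ((1 - |a - b| / (a + b)) * Real.log 2) =
      (a + b) / 2 - |a - b| / 2 := by field_simp
  rw [e, e2] at h1
  linarith

theorem half_sum_sub_sqrt_le_capacityDensity {a b : ℝ} (ha : 0 ≤ a) (hb : 0 ≤ b) :
    (a + b) / 2 - 1 / Real.log 2 * Real.sqrt (a * b) ≤ capacityDensity a b := by
  have hl : 0 < Real.log 2 := Real.log_pos one_lt_two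
  rw [capacityDensity_eq_binEntropy ha hb]
  rcases (add_nonneg ha hb).eq_or_lt with h | h
  · rw [← h]
    simp only [zero_div, zero_mul, sub_zero]
    have : 0 ≤ 1 / Real.log 2 * Real.sqrt (a * b) := by positivity
    linarith
  have h1 := mul_le_mul_of_nonneg_left (Real.binEntropy_le_two_mul_sqrt (p := b / (a + b))
    (by positivity) (by rw [div_le_one h]; linarith))
    (show 0 ≤ (a + b) / (2 * Real.log 2) by positivity)
  have e : Real.sqrt (b / (a + b) * (1 - b / (a + b))) = Real.sqrt (a * b) / (a + b) := by
    have : b / (a + b) * (1 - b / (a + b)) = a * b / (a + b) ^ 2 := by field_simp; ring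
    rw [this, Real.sqrt_div (mul_nonneg ha hb), Real.sqrt_sq h.le]
  have e2 : (a + b) / (2 * Real.log 2) * (2 * (Real.sqrt (a * b) / (a + b))) =
      1 / Real.log 2 * Real.sqrt (a * b) := by field_simp
  rw [e, e2] at h1
  linarith

theorem capacityDensity_mul (r a b : ℝ) :
    capacityDensity (r * a) (r * b) = r * capacityDensity a b := by
  rcases eq_or_ne r 0 with rfl | hr
  · simp [capacityDensity]
  · unfold capacityDensity
    rw [show 1 / 2 * (r * a) + 1 / 2 * (r * b) = r * (1 / 2 * a + 1 / 2 * b) by ring,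
      mul_div_mul_left _ _ hr, mul_div_mul_left _ _ hr]
    ring

theorem measurable_capacityDensity :
    Measurable fun p : ℝ × ℝ => capacityDensity p.1 p.2 := by
  unfold capacityDensity Real.logb
  fun_prop

/-- Up to the linear term `(a + b) / 2` this is a multiple of the perspective of the binary entropy,
so superadditivity is concavity of the entropy. -/
theorem isConcaveHomog_neg_capacityDensity :
    IsConcaveHomog fun a b => -capacityDensity a b where
  meas := measurable_capacityDensity.neg
  homog r a b _ _ _ := by rw [capacityDensity_mul]; ring
  superadd a b a' b' ha hb ha' hb' := by
    have hl : 0 < Real.log 2 := Real.log_pos one_lt_two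
    rw [capacityDensity_eq_binEntropy ha hb, capacityDensity_eq_binEntropy ha' hb',
      capacityDensity_eq_binEntropy (by positivity) (by positivity)]
    have key : (a + b) * Real.binEntropy (b / (a + b)) +
        (a' + b') * Real.binEntropy (b' / (a' + b')) ≤
        (a + a' + (b + b')) * Real.binEntropy ((b + b') / (a + a' + (b + b'))) := by
      rcases (add_nonneg ha hb).eq_or_lt with h | h
      · have ha0 : a = 0 := by linarith
        have hb0 : b = 0 := by linarith
        simp [ha0, hb0]
      rcases (add_nonneg ha' hb').eq_or_lt with h' | h'
      · have ha0 : a' = 0 := by linarith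
        have hb0 : b' = 0 := by linarith
        simp [ha0, hb0]
      have hs : 0 < a + a' + (b + b') := by linarith
      have hx : b / (a + b) ∈ Icc (0 : ℝ) 1 :=
        ⟨by positivity, by rw [div_le_one h]; linarith⟩
      have hy : b' / (a' + b') ∈ Icc (0 : ℝ) 1 :=
        ⟨by positivity, by rw [div_le_one h']; linarith⟩
      have hc := Real.strictConcave_binEntropy.concaveOn.2 hx hy
        (show 0 ≤ (a + b) / (a + a' + (b + b')) by positivity)
        (show 0 ≤ (a' + b') / (a + a' + (b + b')) by positivity) (by field_simp; ring)
      simp only [smul_eq_mul] at hc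
      rw [show (a + b) / (a + a' + (b + b')) * (b / (a + b)) +
        (a' + b') / (a + a' + (b + b')) * (b' / (a' + b')) = (b + b') / (a + a' + (b + b')) by
          field_simp] at hc
      have hc' := mul_le_mul_of_nonneg_left hc hs.le
      refine le_of_eq_of_le ?_ hc'
      field_simp
    have := mul_le_mul_of_nonneg_right key (show 0 ≤ 1 / (2 * Real.log 2) by positivity)
    simp only [div_eq_mul_inv, one_mul] at this ⊢
    linarith
  bound := by
    refine ⟨1, fun a b ha hb => ?_⟩
    rw [abs_neg, abs_of_nonneg (capacityDensity_nonneg ha hb)]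
    have : |a - b| ≤ a + b := abs_sub_le_iff.2 ⟨by linarith, by linarith⟩
    linarith [capacityDensity_le ha hb, abs_nonneg (a - b)]

/-- The pointwise chain rule for mutual information. The sums `ac + bd` and `bc + ad` enter the term
of `P⁻` and the terms of `P⁺` with opposite signs and cancel; all remaining logarithms are of
products. -/
theorem capacityDensity_chain {a b c d : ℝ} (ha : 0 ≤ a) (hb : 0 ≤ b) (hc : 0 ≤ c) (hd : 0 ≤ d) :
    capacityDensity (1 / 2 * (a * c + b * d)) (1 / 2 * (b * c + a * d)) +
      (capacityDensity (1 / 2 * (b * c)) (1 / 2 * (a * d)) +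
        capacityDensity (1 / 2 * (a * c)) (1 / 2 * (b * d))) =
      capacityDensity a b * ((c + d) / 2) + (a + b) / 2 * capacityDensity c d := by
  have hl : Real.log 2 ≠ 0 := (Real.log_pos one_lt_two).ne'
  have hmul : ∀ x y : ℝ, x * y * Real.log (x * y) = x * y * Real.log x + x * y * Real.log y := by
    intro x y
    rcases eq_or_ne x 0 with rfl | hx
    · simp
    rcases eq_or_ne y 0 with rfl | hy
    · simp
    rw [Real.log_mul hx hy, mul_add]
  simp only [capacityDensity_mul]
  rw [capacityDensity_eq_log (by positivity) (by positivity),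
    capacityDensity_eq_log (by positivity) (by positivity),
    capacityDensity_eq_log (by positivity) (by positivity),
    capacityDensity_eq_log ha hb, capacityDensity_eq_log hc hd,
    show a * c + b * d + (b * c + a * d) = (a + b) * (c + d) by ring, add_comm (b * c) (a * d),
    hmul a c, hmul b d, hmul a d, hmul b c, hmul (a + b) (c + d)]
  field_simp
  ring

namespace BMS

theorem I_eq_avg (P : BMS) : P.I = P.avg capacityDensity := by
  unfold I avg capacityDensity
  simp only [Fintype.sum_bool]
  refine integral_congr_ae (Eventually.of_forall fun y => ?_)
  simp only
  ring

theorem integrable_capacityDensity (P : BMS) :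
    Integrable (fun y => capacityDensity (P.w false y) (P.w true y)) P.ν := by
  simpa using (P.integrable_avg isConcaveHomog_neg_capacityDensity).neg

theorem neg_I_eq_avg (P : BMS) : -P.I = P.avg fun a b => -capacityDensity a b := by
  rw [I_eq_avg]
  exact (integral_neg _).symm

theorem I_nonneg (P : BMS) : 0 ≤ P.I := by
  rw [I_eq_avg]
  exact integral_nonneg fun y => capacityDensity_nonneg (P.w_nonneg _ _) (P.w_nonneg _ _)

theorem I_le_T (P : BMS) : P.I ≤ P.T := by
  rw [I_eq_avg]
  exact P.avg_mono P.integrable_capacityDensity P.integrable_T fun a b ha hb =>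
    capacityDensity_le ha hb

theorem I_le_one (P : BMS) : P.I ≤ 1 := P.I_le_T.trans P.T_le_one

theorem one_sub_Z_div_log_two_le_I (P : BMS) : 1 - 1 / Real.log 2 * P.Z ≤ P.I := by
  have e : 1 - 1 / Real.log 2 * P.Z =
      P.avg fun a b => (a + b) / 2 - 1 / Real.log 2 * Real.sqrt (a * b) := by
    unfold avg Z
    rw [integral_sub P.integrable_half_sum (P.integrable_Z.const_mul _), P.integral_half_sum,
      integral_const_mul]
  rw [I_eq_avg, e]
  exact P.avg_mono (Φ := fun a b => (a + b) / 2 - 1 / Real.log 2 * Real.sqrt (a * b))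
    (P.integrable_half_sum.sub (P.integrable_Z.const_mul _)) P.integrable_capacityDensity
    fun a b ha hb => half_sum_sub_sqrt_le_capacityDensity ha hb

theorem one_sub_two_mul_Z_le_I (P : BMS) : 1 - 2 * P.Z ≤ P.I := by
  have h : 1 / Real.log 2 ≤ 2 := by
    rw [div_le_iff₀ (Real.log_pos one_lt_two)]
    linarith [Real.log_two_gt_d9]
  linarith [P.one_sub_Z_div_log_two_le_I, mul_le_mul_of_nonneg_right h P.Z_nonneg]

theorem I_minus_add_I_plus (P : BMS) : P.minus.I + P.plus.I = 2 * P.I := by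
  have hI := P.integrable_capacityDensity
  have hs := P.integrable_half_sum
  have e : 2 * P.I = ∫ z : P.Y × P.Y,
      (capacityDensity (P.w false z.1) (P.w true z.1) * ((P.w false z.2 + P.w true z.2) / 2) +
        (P.w false z.1 + P.w true z.1) / 2 * capacityDensity (P.w false z.2) (P.w true z.2))
      ∂P.ν.prod P.ν := by
    rw [P.integral_symm_kernel hI hs, P.integral_half_sum, mul_one, I_eq_avg]
    rfl
  have hm : Integrable (fun z : P.Y × P.Y =>
      capacityDensity (1 / 2 * (P.w false z.1 * P.w false z.2 + P.w true z.1 * P.w true z.2))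
        (1 / 2 * (P.w true z.1 * P.w false z.2 + P.w false z.1 * P.w true z.2)))
      (P.ν.prod P.ν) := by
    refine (integrable_congr (Eventually.of_forall fun z => ?_)).1
      P.minus.integrable_capacityDensity
    exact congrArg₂ _ (P.minus_w_false z) (P.minus_w_true z)
  have e2 : P.plus.I = 2 * P.I - P.minus.I := by
    rw [e, I_eq_avg, avg_plus _ P.plus.integrable_capacityDensity, I_eq_avg, avg_minus,
      ← integral_sub (P.integrable_symm_kernel hI hs) hm]
    refine integral_congr_ae (Eventually.of_forall fun z => ?_)
    have := capacityDensity_chain (P.w_nonneg false z.1) (P.w_nonneg true z.1)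
      (P.w_nonneg false z.2) (P.w_nonneg true z.2)
    simp only
    linarith
  linarith

end BMS

/-! ### Channels as mixtures of binary symmetric channels -/

/-- The value of the functional `Φ` on a binary symmetric channel with crossover probability `x`. -/
def bscValue (Φ : ℝ → ℝ → ℝ) (x : ℝ) : ℝ := Φ (1 - x) x + Φ x (1 - x)

namespace IsConcaveHomog

variable {Φ : ℝ → ℝ → ℝ}

theorem mul_add_mul_le (h : IsConcaveHomog Φ) {p q a b a' b' : ℝ} (hp : 0 ≤ p) (hq : 0 ≤ q)
    (ha : 0 ≤ a) (hb : 0 ≤ b) (ha' : 0 ≤ a') (hb' : 0 ≤ b') :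
    p * Φ a b + q * Φ a' b' ≤ Φ (p * a + q * a') (p * b + q * b') := by
  rw [← h.homog p a b hp ha hb, ← h.homog q a' b' hq ha' hb']
  exact h.superadd _ _ _ _ (by positivity) (by positivity) (by positivity) (by positivity)

theorem bscValue_centre (h : IsConcaveHomog Φ) {p q x y : ℝ} (hp : 0 ≤ p) (hq : 0 ≤ q)
    (hpq : 0 < p + q) (hx : 0 ≤ x) (hx' : x ≤ 1) (hy : 0 ≤ y) (hy' : y ≤ 1) :
    p * bscValue Φ x + q * bscValue Φ y ≤
      (p + q) * bscValue Φ (p / (p + q) * x + q / (p + q) * y) := by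
  have hx1 : 0 ≤ 1 - x := by linarith
  have hy1 : 0 ≤ 1 - y := by linarith
  have e : p / (p + q) + q / (p + q) = 1 := by field_simp
  have h1 := h.mul_add_mul_le (p := p / (p + q)) (q := q / (p + q)) (by positivity)
    (by positivity) hx1 hx hy1 hy
  have h2 := h.mul_add_mul_le (p := p / (p + q)) (q := q / (p + q)) (by positivity)
    (by positivity) hx hx1 hy hy1
  rw [show p / (p + q) * (1 - x) + q / (p + q) * (1 - y) =
    1 - (p / (p + q) * x + q / (p + q) * y) by linarith] at h1 h2
  have h3 := mul_le_mul_of_nonneg_left (add_le_add h1 h2) hpq.le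
  refine le_of_eq_of_le ?_ h3
  unfold bscValue
  field_simp
  ring

/-- For `x ≤ y ≤ 1/2` the pair `(1 - y, y)` is a convex combination of `(1 - x, x)` and its flip,
that is, `BSC(y)` is `BSC(x)` followed by a further BSC. -/
theorem bscValue_mono (h : IsConcaveHomog Φ) {x y : ℝ} (hx : 0 ≤ x) (hxy : x ≤ y)
    (hy : y ≤ 1 / 2) : bscValue Φ x ≤ bscValue Φ y := by
  rcases hxy.eq_or_lt with rfl | hlt
  · exact le_rfl
  have hd : 0 < 1 - 2 * x := by linarith
  set r := (1 - y - x) / (1 - 2 * x) with hr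
  set s := (y - x) / (1 - 2 * x) with hs
  have hr0 : 0 ≤ r := div_nonneg (by linarith) hd.le
  have hs0 : 0 ≤ s := div_nonneg (by linarith) hd.le
  have e1 : r * (1 - x) + s * x = 1 - y := by
    rw [hr, hs, div_mul_eq_mul_div, div_mul_eq_mul_div, ← add_div, div_eq_iff hd.ne']
    ring
  have e2 : r * x + s * (1 - x) = y := by
    rw [hr, hs, div_mul_eq_mul_div, div_mul_eq_mul_div, ← add_div, div_eq_iff hd.ne']
    ring
  have e3 : r + s = 1 := by linarith
  have hx1 : 0 ≤ 1 - x := by linarith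
  have h1 := h.mul_add_mul_le hr0 hs0 hx1 hx hx hx1
  have h2 := h.mul_add_mul_le hr0 hs0 hx hx1 hx1 hx
  rw [e1, e2] at h1 h2
  unfold bscValue
  have : Φ (1 - x) x + Φ x (1 - x) = (r + s) * (Φ (1 - x) x + Φ x (1 - x)) := by
    rw [e3, one_mul]
  rw [this]
  linarith

theorem add_swap_eq (h : IsConcaveHomog Φ) {a b : ℝ} (ha : 0 ≤ a) (hb : 0 ≤ b) :
    Φ a b + Φ b a = (a + b) * bscValue Φ (min a b / (a + b)) := by
  wlog hab : b ≤ a generalizing a b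
  · rw [min_comm, add_comm a b, add_comm (Φ a b)]
    exact this hb ha (by linarith)
  rw [min_eq_right hab]
  rcases (add_nonneg ha hb).eq_or_lt with hs | hs
  · have ha0 : a = 0 := by linarith
    have hb0 : b = 0 := by linarith
    have := h.homog 0 0 0 le_rfl le_rfl le_rfl
    simp only [mul_zero, zero_mul] at this
    simp [ha0, hb0, this]
  · have e : 1 - b / (a + b) = a / (a + b) := by field_simp; ring
    unfold bscValue
    rw [e, mul_add, ← h.homog _ _ _ hs.le (by positivity) (by positivity),
      ← h.homog _ _ _ hs.le (by positivity) (by positivity), mul_div_cancel₀ _ hs.ne',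
      mul_div_cancel₀ _ hs.ne']

end IsConcaveHomog

namespace BMS

/-- By `avg_swap` only the symmetrization of `Φ` counts, and by homogeneity it sees an output only
through its weight and its crossover probability. -/
theorem avg_eq_integral_bscValue (P : BMS) {Φ : ℝ → ℝ → ℝ} (h : IsConcaveHomog Φ) :
    P.avg Φ = ∫ y, (P.w false y + P.w true y) / 2 * bscValue Φ (P.chi y) ∂P.ν := by
  have h2 : P.avg Φ + P.avg (fun a b => Φ b a) =
      ∫ y, 2 * ((P.w false y + P.w true y) / 2 * bscValue Φ (P.chi y)) ∂P.ν := by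
    unfold avg
    rw [← integral_add (P.integrable_avg h) (P.integrable_avg h.swap)]
    refine integral_congr_ae (Eventually.of_forall fun y => ?_)
    simp only
    rw [h.add_swap_eq (P.w_nonneg _ _) (P.w_nonneg _ _)]
    unfold chi
    ring
  rw [P.avg_swap Φ, integral_const_mul] at h2
  linarith

theorem avg_ofMasses (l : List (ℝ × ℝ)) (hl : IsMassList l) {Φ : ℝ → ℝ → ℝ}
    (h : IsConcaveHomog Φ) :
    (ofMasses l hl).avg Φ = (l.map fun a => a.1 * bscValue Φ a.2).sum := by
  have e : (ofMasses l hl).avg Φ = ∫ y : Fin l.length × Bool,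
      Φ ((l.get y.1).1 * if y.2 = false then 1 - (l.get y.1).2 else (l.get y.1).2)
        ((l.get y.1).1 * if y.2 = true then 1 - (l.get y.1).2 else (l.get y.1).2)
        ∂Measure.count := rfl
  rw [e, integral_count, Fintype.sum_prod_type]
  have : ∀ i : Fin l.length, ∑ c : Bool,
      Φ ((l.get i).1 * if c = false then 1 - (l.get i).2 else (l.get i).2)
        ((l.get i).1 * if c = true then 1 - (l.get i).2 else (l.get i).2) =
      (l.get i).1 * bscValue Φ (l.get i).2 := fun i => by
    obtain ⟨h1, h2, h3⟩ := hl.1 _ (l.get_mem i)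
    simp only [Fintype.sum_bool, if_true, reduceCtorEq, if_false]
    rw [h.homog _ _ _ h1.le h2 (by linarith), h.homog _ _ _ h1.le (by linarith) h2]
    unfold bscValue
    ring
  simp only [this]
  rw [← List.sum_ofFn]
  congr 1
  conv_rhs => rw [← List.ofFn_get l, List.map_ofFn]
  rfl

theorem card_ofMasses (l : List (ℝ × ℝ)) (hl : IsMassList l) :
    Nat.card (ofMasses l hl).Y = 2 * l.length := by
  change Nat.card (Fin l.length × Bool) = _
  simp [mul_comm]

theorem finite_ofMasses (l : List (ℝ × ℝ)) (hl : IsMassList l) : Finite (ofMasses l hl).Y :=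
  inferInstanceAs (Finite (Fin l.length × Bool))

/-! ### Relabelling the crossover probabilities -/

open Classical in
/-- The masses obtained when the output `y` is assigned the crossover probability `r y`. -/
def massesOf (P : BMS) (r : P.Y → ℝ) (hr : (Set.range r).Finite) : List (ℝ × ℝ) :=
  ((hr.toFinset.filter fun x =>
      0 < ∫ y in r ⁻¹' {x}, (P.w false y + P.w true y) / 2 ∂P.ν).sort (· ≤ ·)).map
    fun x => (∫ y in r ⁻¹' {x}, (P.w false y + P.w true y) / 2 ∂P.ν, x)

theorem masses_eq_massesOf (P : BMS) [Finite P.Y] :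
    P.masses = P.massesOf P.chi (Set.finite_range _) := rfl

theorem mem_massesOf {P : BMS} {r : P.Y → ℝ} {hr : (Set.range r).Finite} {a : ℝ × ℝ}
    (ha : a ∈ P.massesOf r hr) : 0 < a.1 ∧ a.2 ∈ Set.range r := by
  simp only [massesOf, List.mem_map, Finset.mem_sort, Finset.mem_filter,
    Set.Finite.mem_toFinset] at ha
  obtain ⟨x, ⟨hx, hx'⟩, rfl⟩ := ha
  exact ⟨hx', hx⟩

theorem length_massesOf_le (P : BMS) (r : P.Y → ℝ) (hr : (Set.range r).Finite) :
    (P.massesOf r hr).length ≤ (Set.range r).ncard := by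
  rw [massesOf, List.length_map, Finset.length_sort, Set.ncard_eq_toFinset_card _ hr]
  exact Finset.card_filter_le _ _

theorem sum_massesOf (P : BMS) {r : P.Y → ℝ} (hm : Measurable r) (hr : (Set.range r).Finite)
    (g : ℝ → ℝ) : ((P.massesOf r hr).map fun a => a.1 * g a.2).sum =
      ∫ y, (P.w false y + P.w true y) / 2 * g (r y) ∂P.ν := by
  classical
  set m : ℝ → ℝ := fun x => ∫ y in r ⁻¹' {x}, (P.w false y + P.w true y) / 2 ∂P.ν with hmdef
  have hm0 : ∀ x, 0 ≤ m x := fun x => integral_nonneg fun y =>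
    div_nonneg (add_nonneg (P.w_nonneg false y) (P.w_nonneg true y)) (by norm_num)
  have h1 : ((P.massesOf r hr).map fun a => a.1 * g a.2).sum =
      ∑ x ∈ hr.toFinset.filter (fun x => 0 < m x), m x * g x := by
    simp only [massesOf, List.map_map]
    rw [← Finset.sum_map_toList]
    exact ((Finset.sort_perm_toList _ (· ≤ ·)).map _).sum_eq
  have h2 : ∑ x ∈ hr.toFinset.filter (fun x => 0 < m x), m x * g x =
      ∑ x ∈ hr.toFinset, m x * g x := by
    -- The positions discarded from the list have mass zero.
    refine Finset.sum_subset (Finset.filter_subset _ _) fun x hx hx' => ?_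
    have : m x = 0 := by
      by_contra hne
      exact hx' (Finset.mem_filter.2 ⟨hx, lt_of_le_of_ne (hm0 x) (Ne.symm hne)⟩)
    rw [this, zero_mul]
  have hms : ∀ x, MeasurableSet (r ⁻¹' {x}) := fun x => hm (measurableSet_singleton x)
  have hcongr : ∀ x, EqOn (fun y => (P.w false y + P.w true y) / 2 * g x)
      (fun y => (P.w false y + P.w true y) / 2 * g (r y)) (r ⁻¹' {x}) := by
    intro x y hy
    have : r y = x := hy
    simp only [this]
  have h3 : ∑ x ∈ hr.toFinset, m x * g x =
      ∫ y in ⋃ x ∈ hr.toFinset, r ⁻¹' {x}, (P.w false y + P.w true y) / 2 * g (r y) ∂P.ν := by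
    rw [integral_biUnion_finset _ (fun x _ => hms x)]
    · refine Finset.sum_congr rfl fun x _ => ?_
      rw [← setIntegral_congr_fun (hms x) (hcongr x), integral_mul_const]
    · intro x _ x' _ hne
      exact Disjoint.preimage _ (by simpa using hne)
    · intro x _
      exact (P.integrable_half_sum.mul_const (g x)).integrableOn.congr_fun (hcongr x) (hms x)
  have h4 : (⋃ x ∈ hr.toFinset, r ⁻¹' {x}) = Set.univ := by
    ext y
    simp
  rw [h1, h2, h3, h4, setIntegral_univ]

theorem isMassList_massesOf (P : BMS) {r : P.Y → ℝ} (hm : Measurable r)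
    (hr : (Set.range r).Finite) (h0 : ∀ y, 0 ≤ r y ∧ r y ≤ 1 / 2) :
    IsMassList (P.massesOf r hr) := by
  refine ⟨fun a ha => ?_, ?_⟩
  · obtain ⟨h1, y, hy⟩ := mem_massesOf ha
    exact ⟨h1, hy ▸ h0 y⟩
  · have := P.sum_massesOf hm hr fun _ => 1
    simp only [mul_one, P.integral_half_sum] at this
    exact this

theorem avg_ofMasses_masses (P : BMS) [Finite P.Y] (h : IsMassList P.masses) {Φ : ℝ → ℝ → ℝ}
    (hΦ : IsConcaveHomog Φ) : (ofMasses P.masses h).avg Φ = P.avg Φ := by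
  rw [avg_ofMasses _ _ hΦ, masses_eq_massesOf, P.sum_massesOf P.measurable_chi,
    P.avg_eq_integral_bscValue hΦ]

theorem length_masses_le (P : BMS) [Finite P.Y] : P.masses.length ≤ Nat.card P.Y := by
  rw [masses_eq_massesOf]
  refine (P.length_massesOf_le _ _).trans ?_
  rw [← Set.image_univ, ← Set.ncard_univ]
  exact Set.ncard_image_le

theorem pairwise_masses (P : BMS) [Finite P.Y] : P.masses.Pairwise fun a b => a.2 ≤ b.2 := by
  rw [masses, List.pairwise_map]
  exact Finset.pairwise_sort _ _

/-- The crossover probability, rounded up to the next multiple of `1 / (2 M)`. -/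
def chiGrid (P : BMS) (M : ℕ) (y : P.Y) : ℝ := (⌈2 * M * P.chi y⌉₊ : ℝ) / (2 * M)

theorem measurable_chiGrid (P : BMS) (M : ℕ) : Measurable (P.chiGrid M) := by
  have : Measurable fun y => (⌈2 * M * P.chi y⌉₊ : ℝ) :=
    measurable_from_top.comp (Nat.measurable_ceil.comp (P.measurable_chi.const_mul _))
  exact this.div_const _

theorem range_chiGrid_subset (P : BMS) (M : ℕ) : Set.range (P.chiGrid M) ⊆
    ((Finset.range (M + 1)).image fun j : ℕ => (j : ℝ) / (2 * M) : Finset ℝ) := by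
  rintro _ ⟨y, rfl⟩
  simp only [Finset.coe_image, Finset.coe_range, Set.mem_image, Set.mem_Iio]
  refine ⟨_, ?_, rfl⟩
  rw [Nat.lt_succ_iff, Nat.ceil_le]
  have := (P.chi_mem y).2
  have hM : (0 : ℝ) ≤ M := Nat.cast_nonneg M
  nlinarith

theorem finite_range_chiGrid (P : BMS) (M : ℕ) : (Set.range (P.chiGrid M)).Finite :=
  (Finset.finite_toSet _).subset (P.range_chiGrid_subset M)

theorem ncard_range_chiGrid_le (P : BMS) (M : ℕ) : (Set.range (P.chiGrid M)).ncard ≤ M + 1 := by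
  refine (Set.ncard_le_ncard (P.range_chiGrid_subset M) (Finset.finite_toSet _)).trans ?_
  rw [Set.ncard_coe_finset]
  exact Finset.card_image_le.trans_eq (Finset.card_range _)

theorem chi_le_chiGrid (P : BMS) {M : ℕ} (hM : 0 < M) (y : P.Y) : P.chi y ≤ P.chiGrid M y := by
  have hM' : (0 : ℝ) < M := Nat.cast_pos.2 hM
  rw [chiGrid, le_div_iff₀ (by positivity), mul_comm]
  exact Nat.le_ceil _

theorem chiGrid_le_chi_add (P : BMS) {M : ℕ} (hM : 0 < M) (y : P.Y) :
    P.chiGrid M y ≤ P.chi y + 1 / (2 * M) := by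
  have hM' : (0 : ℝ) < M := Nat.cast_pos.2 hM
  have h := (Nat.ceil_lt_add_one (a := 2 * M * P.chi y)
    (mul_nonneg (by positivity) (P.chi_mem y).1)).le
  rw [chiGrid, div_le_iff₀ (by positivity), add_mul, div_mul_cancel₀ _ (by positivity)]
  linarith

theorem chiGrid_mem (P : BMS) {M : ℕ} (hM : 0 < M) (y : P.Y) :
    0 ≤ P.chiGrid M y ∧ P.chiGrid M y ≤ 1 / 2 := by
  refine ⟨(P.chi_mem y).1.trans (P.chi_le_chiGrid hM y), ?_⟩
  obtain ⟨j, hj, e⟩ := Finset.mem_image.1 (P.range_chiGrid_subset M ⟨y, rfl⟩)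
  have hM' : (0 : ℝ) < M := Nat.cast_pos.2 hM
  have hj' : (j : ℝ) ≤ M := by exact_mod_cast Nat.lt_succ_iff.1 (Finset.mem_range.1 hj)
  rw [← e, div_le_iff₀ (by positivity)]
  linarith

/-- The channel with at most `M + 1` masses obtained by rounding up the crossover probabilities. -/
def gridQuantize (P : BMS) (M : ℕ) (hM : 0 < M) : BMS :=
  ofMasses (P.massesOf (P.chiGrid M) (P.finite_range_chiGrid M))
    (P.isMassList_massesOf (P.measurable_chiGrid M) _ (P.chiGrid_mem hM))

theorem card_gridQuantize_le (P : BMS) (M : ℕ) (hM : 0 < M) :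
    Nat.card (P.gridQuantize M hM).Y ≤ 2 * (M + 1) := by
  rw [gridQuantize, card_ofMasses]
  exact Nat.mul_le_mul_left 2 ((P.length_massesOf_le _ _).trans (P.ncard_range_chiGrid_le M))

theorem avg_gridQuantize (P : BMS) (M : ℕ) (hM : 0 < M) {Φ : ℝ → ℝ → ℝ} (h : IsConcaveHomog Φ) :
    (P.gridQuantize M hM).avg Φ =
      ∫ y, (P.w false y + P.w true y) / 2 * bscValue Φ (P.chiGrid M y) ∂P.ν := by
  rw [gridQuantize, avg_ofMasses _ _ h, P.sum_massesOf (P.measurable_chiGrid M)]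

theorem measurable_bscValue {Φ : ℝ → ℝ → ℝ} (h : IsConcaveHomog Φ) : Measurable (bscValue Φ) :=
  (h.comp_measurable (by fun_prop) (by fun_prop)).add
    (h.comp_measurable (by fun_prop) (by fun_prop))

theorem integrable_mul_bscValue (P : BMS) {Φ : ℝ → ℝ → ℝ} (h : IsConcaveHomog Φ) {r : P.Y → ℝ}
    (hm : Measurable r) (h0 : ∀ y, 0 ≤ r y ∧ r y ≤ 1 / 2) :
    Integrable (fun y => (P.w false y + P.w true y) / 2 * bscValue Φ (r y)) P.ν := by
  obtain ⟨C, hC⟩ := h.bound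
  refine P.integrable_half_sum.mul_bdd (c := 2 * C)
    ((measurable_bscValue h).comp hm).aestronglyMeasurable (Eventually.of_forall fun y => ?_)
  have h1 := hC (1 - r y) (r y) (by linarith [(h0 y).2]) (h0 y).1
  have h2 := hC (r y) (1 - r y) (h0 y).1 (by linarith [(h0 y).2])
  refine (abs_add_le _ _).trans ?_
  linarith

/-- Rounding up moves each crossover probability towards `1/2`, so `bscValue_mono` applies under the
integral. -/
theorem degrades_gridQuantize (P : BMS) (M : ℕ) (hM : 0 < M) :
    Degrades P (P.gridQuantize M hM) := by
  intro Φ h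
  rw [P.avg_gridQuantize M hM h, P.avg_eq_integral_bscValue h]
  refine integral_mono (P.integrable_mul_bscValue h P.measurable_chi P.chi_mem)
    (P.integrable_mul_bscValue h (P.measurable_chiGrid M) (P.chiGrid_mem hM)) fun y => ?_
  refine mul_le_mul_of_nonneg_left (h.bscValue_mono (P.chi_mem y).1 (P.chi_le_chiGrid hM y)
    (P.chiGrid_mem hM y).2) ?_
  exact div_nonneg (add_nonneg (P.w_nonneg false y) (P.w_nonneg true y)) (by norm_num)

theorem bscValue_neg_capacityDensity {x : ℝ} (h0 : 0 ≤ x) (h1 : x ≤ 1) :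
    bscValue (fun a b => -capacityDensity a b) x = Real.binEntropy x / Real.log 2 - 1 := by
  have hl : Real.log 2 ≠ 0 := (Real.log_pos one_lt_two).ne'
  simp only [bscValue]
  rw [capacityDensity_eq_binEntropy (by linarith) h0,
    capacityDensity_eq_binEntropy h0 (by linarith)]
  simp only [sub_add_cancel, add_sub_cancel, div_one, Real.binEntropy_one_sub]
  field_simp
  ring

/-- Fine grids lose arbitrarily little capacity, uniformly over all channels. -/
theorem exists_abs_I_gridQuantize_sub_le {ε : ℝ} (hε : 0 < ε) :
    ∃ (M : ℕ) (hM : 0 < M), ∀ P : BMS, |(P.gridQuantize M hM).I - P.I| ≤ ε := by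
  have hl : 0 < Real.log 2 := Real.log_pos one_lt_two
  have huc : UniformContinuousOn Real.binEntropy (Icc 0 1) :=
    isCompact_Icc.uniformContinuousOn_of_continuous Real.binEntropy_continuous.continuousOn
  obtain ⟨η, hη, hu⟩ := Metric.uniformContinuousOn_iff.1 huc (ε * Real.log 2) (by positivity)
  -- The mesh `1 / (2 * M)` has to stay below the modulus of continuity `η` of the entropy, which
  -- does not depend on the channel.
  obtain ⟨M, hM⟩ := exists_nat_gt (1 / η)
  have hM0 : (0 : ℝ) < M := lt_trans (by positivity) hM
  have hMpos : 0 < M := Nat.cast_pos.1 hM0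
  have hMη : 1 / (2 * (M : ℝ)) < η := by
    rw [div_lt_iff₀ hη] at hM
    rw [div_lt_iff₀ (by positivity)]
    nlinarith
  refine ⟨M, hMpos, fun P => ?_⟩
  have hc := isConcaveHomog_neg_capacityDensity
  have i1 := P.integrable_mul_bscValue hc P.measurable_chi P.chi_mem
  have i2 := P.integrable_mul_bscValue hc (P.measurable_chiGrid M) (P.chiGrid_mem hMpos)
  have e : P.I - (P.gridQuantize M hMpos).I = ∫ y, ((P.w false y + P.w true y) / 2 *
        bscValue (fun a b => -capacityDensity a b) (P.chiGrid M y) -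
      (P.w false y + P.w true y) / 2 *
        bscValue (fun a b => -capacityDensity a b) (P.chi y)) ∂P.ν := by
    rw [integral_sub i2 i1, ← P.avg_gridQuantize M hMpos hc, ← P.avg_eq_integral_bscValue hc,
      ← neg_I_eq_avg, ← neg_I_eq_avg]
    ring
  rw [abs_sub_comm, e]
  have hb : ∫ y, (P.w false y + P.w true y) / 2 * ε ∂P.ν = ε := by
    rw [integral_mul_const, P.integral_half_sum, one_mul]
  rw [← hb, ← Real.norm_eq_abs]
  refine norm_integral_le_of_norm_le (P.integrable_half_sum.mul_const ε)
    (Eventually.of_forall fun y => ?_)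
  have hs : 0 ≤ (P.w false y + P.w true y) / 2 :=
    div_nonneg (add_nonneg (P.w_nonneg false y) (P.w_nonneg true y)) (by norm_num)
  obtain ⟨g0, g1⟩ := P.chiGrid_mem hMpos y
  obtain ⟨c0, c1⟩ := P.chi_mem y
  rw [← mul_sub, Real.norm_eq_abs, abs_mul, abs_of_nonneg hs]
  refine mul_le_mul_of_nonneg_left ?_ hs
  rw [bscValue_neg_capacityDensity g0 (by linarith), bscValue_neg_capacityDensity c0 (by linarith)]
  have hd := hu (P.chiGrid M y) ⟨g0, by linarith⟩ (P.chi y) ⟨c0, by linarith⟩ (by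
    rw [Real.dist_eq, abs_of_nonneg (by linarith [P.chi_le_chiGrid hMpos y])]
    linarith [P.chiGrid_le_chi_add hMpos y])
  rw [Real.dist_eq] at hd
  rw [sub_sub_sub_cancel_right, ← sub_div, abs_div, abs_of_pos hl, div_le_iff₀ hl]
  exact hd.le

end BMS

/-! ### The greedy algorithms degrade -/

theorem massCentre_mem {a b : ℝ × ℝ} (ha : 0 < a.1) (hb : 0 < b.1) (hab : a.2 ≤ b.2) :
    a.2 ≤ massCentre a b ∧ massCentre a b ≤ b.2 := by
  have hs : 0 < a.1 + b.1 := add_pos ha hb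
  have hc : massCentre a b = (a.1 * a.2 + b.1 * b.2) / (a.1 + b.1) := by
    unfold massCentre
    ring
  rw [hc, le_div_iff₀ hs, div_le_iff₀ hs]
  constructor <;> nlinarith

namespace MassAlgorithm

theorem join_snd_mem (A : MassAlgorithm) {a b : ℝ × ℝ} (ha : 0 < a.1) (hb : 0 < b.1)
    (hab : a.2 ≤ b.2) : a.2 ≤ (A.join a b).2 ∧ (A.join a b).2 ≤ b.2 := by
  cases A
  · exact ⟨hab, le_rfl⟩
  · exact massCentre_mem ha hb hab

/-- Transportation raises the crossover probability of `a` to that of `b` (`bscValue_mono`); merging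
moves both to their centre of mass (concavity). So joining any neighbours degrades. -/
theorem le_join_value (A : MassAlgorithm) {Φ : ℝ → ℝ → ℝ} (h : IsConcaveHomog Φ) {a b : ℝ × ℝ}
    (ha : 0 < a.1 ∧ 0 ≤ a.2 ∧ a.2 ≤ 1 / 2) (hb : 0 < b.1 ∧ 0 ≤ b.2 ∧ b.2 ≤ 1 / 2)
    (hab : a.2 ≤ b.2) : a.1 * bscValue Φ a.2 + b.1 * bscValue Φ b.2 ≤
      (A.join a b).1 * bscValue Φ (A.join a b).2 := by
  cases A
  · simp only [join]
    rw [add_mul]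
    have := mul_le_mul_of_nonneg_left (h.bscValue_mono ha.2.1 hab hb.2.2) ha.1.le
    linarith
  · exact h.bscValue_centre ha.1.le hb.1.le (add_pos ha.1 hb.1) ha.2.1 (by linarith) hb.2.1
      (by linarith)

theorem le_snd_of_mem_joinAt (A : MassAlgorithm) (j : ℕ) (l : List (ℝ × ℝ)) (c : ℝ)
    (h : ∀ a ∈ l, 0 < a.1) (hl : l.Pairwise fun a b => a.2 ≤ b.2) (hc : ∀ a ∈ l, c ≤ a.2) :
    ∀ a ∈ A.joinAt j l, c ≤ a.2 := by
  fun_induction joinAt A j l with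
  | case1 a b t =>
    intro x hx
    rcases List.mem_cons.1 hx with rfl | hx
    · exact (hc a (by simp)).trans
        (A.join_snd_mem (h a (by simp)) (h b (by simp)) (List.rel_of_pairwise_cons hl (by simp))).1
    · exact hc x (by simp [hx])
  | case2 j a t ih =>
    intro x hx
    rcases List.mem_cons.1 hx with rfl | hx
    · exact hc _ (by simp)
    · exact ih (fun y hy => h y (by simp [hy])) hl.of_cons (fun y hy => hc y (by simp [hy])) x hx
  | case3 => exact hc

/-- Transportation degrades only when the right neighbour is the noisier one, so the order has to
survive every step. -/
theorem pairwise_joinAt (A : MassAlgorithm) (j : ℕ) (l : List (ℝ × ℝ))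
    (h : ∀ a ∈ l, 0 < a.1) (hl : l.Pairwise fun a b => a.2 ≤ b.2) :
    (A.joinAt j l).Pairwise fun a b => a.2 ≤ b.2 := by
  fun_induction joinAt A j l with
  | case1 a b t =>
    refine List.pairwise_cons.2 ⟨fun x hx => ?_, hl.of_cons.of_cons⟩
    exact (A.join_snd_mem (h a (by simp)) (h b (by simp))
      (List.rel_of_pairwise_cons hl (by simp))).2.trans (List.rel_of_pairwise_cons hl.of_cons hx)
  | case2 j a t ih =>
    have h' : ∀ y ∈ t, 0 < y.1 := fun y hy => h y (by simp [hy])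
    refine List.pairwise_cons.2 ⟨?_, ih h' hl.of_cons⟩
    exact A.le_snd_of_mem_joinAt j t a.2 h' hl.of_cons fun y hy => List.rel_of_pairwise_cons hl hy
  | case3 => exact hl

theorem sum_le_sum_joinAt (A : MassAlgorithm) {Φ : ℝ → ℝ → ℝ} (hΦ : IsConcaveHomog Φ) (j : ℕ)
    (l : List (ℝ × ℝ)) (h : ∀ a ∈ l, 0 < a.1 ∧ 0 ≤ a.2 ∧ a.2 ≤ 1 / 2)
    (hl : l.Pairwise fun a b => a.2 ≤ b.2) :
    (l.map fun a => a.1 * bscValue Φ a.2).sum ≤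
      ((A.joinAt j l).map fun a => a.1 * bscValue Φ a.2).sum := by
  fun_induction joinAt A j l with
  | case1 a b t =>
    simp only [List.map_cons, List.sum_cons]
    have := A.le_join_value hΦ (h a (by simp)) (h b (by simp))
      (List.rel_of_pairwise_cons hl (by simp))
    linarith
  | case2 j a t ih =>
    simp only [List.map_cons, List.sum_cons]
    have := ih (fun y hy => h y (by simp [hy])) hl.of_cons
    linarith
  | case3 => exact le_rfl

theorem length_joinAt (A : MassAlgorithm) (j : ℕ) (l : List (ℝ × ℝ)) (h : j + 1 < l.length) :
    (A.joinAt j l).length + 1 = l.length := by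
  fun_induction joinAt A j l with
  | case1 a b t => simp
  | case2 j a t ih =>
    simp only [List.length_cons] at h ⊢
    rw [ih (by omega)]
  | case3 j l h1 h2 =>
    exfalso
    rcases j with _ | j
    · rcases l with _ | ⟨a, _ | ⟨b, t⟩⟩
      · simp at h
      · simp at h
      · exact h1 a b t rfl rfl
    · rcases l with _ | ⟨a, t⟩
      · simp at h
      · exact h2 j a t rfl rfl

theorem length_costs (A : MassAlgorithm) (f : ℝ → ℝ) (l : List (ℝ × ℝ)) :
    (A.costs f l).length = l.length - 1 := by
  fun_induction costs A f l with
  | case1 a b t ih => simp [ih]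
  | case2 l h =>
    rcases l with _ | ⟨a, _ | ⟨b, t⟩⟩
    · rfl
    · rfl
    · exact absurd rfl (h a b t)

/-- A step removes one mass, except that lists of length `0` or `1` have no neighbours and stay. -/
theorem length_step (A : MassAlgorithm) (f : ℝ → ℝ) (l : List (ℝ × ℝ)) :
    (A.step f l).length = max (l.length - 1) (min l.length 1) := by
  unfold step
  split
  · rename_i j hj
    have hm := List.mem_range.1 (List.argmin_mem hj)
    rw [length_costs] at hm
    have := A.length_joinAt j l (by omega)
    omega
  · rename_i hj
    rw [List.argmin_eq_none, List.range_eq_nil, length_costs] at hj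
    omega

theorem step_props (A : MassAlgorithm) (f : ℝ → ℝ) {Φ : ℝ → ℝ → ℝ} (hΦ : IsConcaveHomog Φ)
    {l : List (ℝ × ℝ)} (h : IsMassList l) (hl : l.Pairwise fun a b => a.2 ≤ b.2) :
    ((A.step f l).Pairwise fun a b => a.2 ≤ b.2) ∧
      (l.map fun a => a.1 * bscValue Φ a.2).sum ≤
        ((A.step f l).map fun a => a.1 * bscValue Φ a.2).sum := by
  unfold step
  split
  · exact ⟨A.pairwise_joinAt _ l (fun a ha => (h.1 a ha).1) hl,
      A.sum_le_sum_joinAt hΦ _ l h.1 hl⟩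
  · exact ⟨hl, le_rfl⟩

theorem sum_le_sum_run (A : MassAlgorithm) (f : ℝ → ℝ) (k : ℕ) {Φ : ℝ → ℝ → ℝ}
    (hΦ : IsConcaveHomog Φ) {l : List (ℝ × ℝ)} (h : IsMassList l)
    (hl : l.Pairwise fun a b => a.2 ≤ b.2) :
    (l.map fun a => a.1 * bscValue Φ a.2).sum ≤
      ((A.run f k l).map fun a => a.1 * bscValue Φ a.2).sum := by
  unfold run
  generalize l.length - k = n
  induction n generalizing l with
  | zero => exact le_rfl
  | succ n ih =>
    rw [Function.iterate_succ_apply]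
    have hs := A.step_props f hΦ h hl
    exact hs.2.trans (ih (h.step A f) hs.1)

theorem length_run_le (A : MassAlgorithm) (f : ℝ → ℝ) {k : ℕ} (hk : 1 ≤ k) (l : List (ℝ × ℝ)) :
    (A.run f k l).length ≤ k := by
  have key : ∀ (n : ℕ) (l : List (ℝ × ℝ)),
      ((A.step f)^[n] l).length ≤ max (l.length - n) 1 := by
    intro n
    induction n with
    | zero => intro l; simp
    | succ n ih =>
      intro l
      rw [Function.iterate_succ_apply]
      refine (ih _).trans ?_
      rw [length_step]
      omega
  refine (key _ l).trans ?_
  omega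

theorem length_run_le_length (A : MassAlgorithm) (f : ℝ → ℝ) (k : ℕ) (l : List (ℝ × ℝ)) :
    (A.run f k l).length ≤ l.length := by
  unfold run
  generalize l.length - k = n
  induction n with
  | zero => exact le_rfl
  | succ n ih =>
    rw [Function.iterate_succ_apply', length_step]
    omega

theorem run_of_length_le (A : MassAlgorithm) (f : ℝ → ℝ) {k : ℕ} {l : List (ℝ × ℝ)}
    (h : l.length ≤ k) : A.run f k l = l := by
  unfold run
  rw [Nat.sub_eq_zero_of_le h]
  rfl

end MassAlgorithm

namespace BMS

theorem ofMasses_congr {l l' : List (ℝ × ℝ)} (h : l = l') (hl : IsMassList l)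
    (hl' : IsMassList l') : ofMasses l hl = ofMasses l' hl' := by
  subst h
  rfl

/-! ### Erasure channels -/

/-- Every output symbol either determines the input or carries no information about it. -/
def IsErasure (P : BMS) : Prop := ∀ y, P.w false y * P.w true y = 0 ∨ P.w false y = P.w true y

theorem IsErasure.minus {P : BMS} (h : P.IsErasure) : P.minus.IsErasure := by
  intro y
  rw [show P.minus.w false y = _ from P.minus_w_false y,
    show P.minus.w true y = _ from P.minus_w_true y]
  rcases h y.1 with h1 | h1
  · rcases h y.2 with h2 | h2
    · left
      rcases mul_eq_zero.1 h1 with e1 | e1 <;> rcases mul_eq_zero.1 h2 with e2 | e2 <;>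
        simp [e1, e2]
    · right
      rw [h2]
      ring
  · right
    rw [h1]

theorem IsErasure.plus {P : BMS} (h : P.IsErasure) : P.plus.IsErasure := by
  rintro ⟨y₁, y₂, u⟩
  simp only [BMS.plus]
  rcases h y₁ with h1 | h1
  · left
    cases u <;> rcases mul_eq_zero.1 h1 with e | e <;> simp [e]
  · rcases h y₂ with h2 | h2
    · left
      rcases mul_eq_zero.1 h2 with e | e <;> simp [e]
    · right
      cases u <;> simp [h1, h2]

theorem IsErasure.child {P : BMS} (h : P.IsErasure) (b : Bool) : (P.child b).IsErasure := by
  cases b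
  · exact h.minus
  · exact h.plus

theorem isErasure_bec (e : ℝ) (h0 : 0 ≤ e) (h1 : e ≤ 1) : (bec e h0 h1).IsErasure := by
  intro y
  change Option Bool at y
  rcases y with _ | c
  · right
    rfl
  · left
    cases c <;> simp [bec]

theorem Z_bec (e : ℝ) (h0 : 0 ≤ e) (h1 : e ≤ 1) : (bec e h0 h1).Z = e := by
  let _ : MeasurableSpace (Option Bool) := ⊤
  have : (bec e h0 h1).Z = ∫ y : Option Bool, Real.sqrt
      ((y.elim e fun c => if c = false then 1 - e else 0) *
        (y.elim e fun c => if c = true then 1 - e else 0)) ∂Measure.count := rfl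
  rw [this, integral_count, Fintype.sum_option]
  simp [Real.sqrt_mul_self h0]

theorem IsErasure.T_eq {P : BMS} (h : P.IsErasure) : P.T = 1 - P.Z := by
  rw [← P.integral_half_sum, Z_eq_avg]
  unfold T avg
  rw [← integral_sub P.integrable_half_sum P.integrable_Z]
  refine integral_congr_ae (Eventually.of_forall fun y => ?_)
  have h0 := P.w_nonneg false y
  have h1 := P.w_nonneg true y
  simp only
  rcases h y with e | e
  · rw [e, Real.sqrt_zero]
    rcases mul_eq_zero.1 e with e | e
    · rw [e, zero_sub, abs_neg, abs_of_nonneg h1]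
      ring
    · rw [e, sub_zero, abs_of_nonneg h0]
      ring
  · rw [e, Real.sqrt_mul_self h1]
    simp

theorem capacityDensity_self (a : ℝ) : capacityDensity a a = 0 := by
  unfold capacityDensity
  rw [show 1 / 2 * a + 1 / 2 * a = a by ring]
  rcases eq_or_ne a 0 with rfl | ha
  · simp
  · simp [div_self ha]

theorem capacityDensity_zero_right {a : ℝ} (ha : 0 ≤ a) : capacityDensity a 0 = a / 2 := by
  rw [capacityDensity_eq_binEntropy ha le_rfl]
  simp

theorem capacityDensity_zero_left {a : ℝ} (ha : 0 ≤ a) : capacityDensity 0 a = a / 2 := by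
  rw [capacityDensity_eq_binEntropy le_rfl ha]
  rcases ha.eq_or_lt with rfl | h
  · simp
  · simp [div_self h.ne']

theorem IsErasure.I_eq {P : BMS} (h : P.IsErasure) : P.I = P.T := by
  rw [I_eq_avg]
  refine integral_congr_ae (Eventually.of_forall fun y => ?_)
  have h0 := P.w_nonneg false y
  have h1 := P.w_nonneg true y
  simp only
  rcases h y with e | e
  · rcases mul_eq_zero.1 e with e | e
    · rw [e, capacityDensity_zero_left h1, zero_sub, abs_neg, abs_of_nonneg h1]
    · rw [e, capacityDensity_zero_right h0, sub_zero, abs_of_nonneg h0]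
  · rw [e, capacityDensity_self]
    simp

/-- Since `T = 1 - Z` on erasure channels, `Z(P⁺) = Z²` gives `T(P⁺) = 2T - T²`: the equality case
of `T_minus_add_T_plus_le`. -/
theorem IsErasure.T_minus_add_T_plus {P : BMS} (h : P.IsErasure) :
    P.minus.T + P.plus.T = 2 * P.T := by
  rw [T_minus, h.plus.T_eq, Z_plus, show P.Z = 1 - P.T by rw [h.T_eq]; ring]
  ring

theorem IsErasure.Z_minus {P : BMS} (h : P.IsErasure) : P.minus.Z = 2 * P.Z - P.Z ^ 2 := by
  have h1 := h.minus.T_eq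
  rw [T_minus, h.T_eq] at h1
  linarith

theorem IsErasure.chi_eq {P : BMS} (h : P.IsErasure) (y : P.Y) : P.chi y = 0 ∨ P.chi y = 1 / 2 := by
  have h0 := P.w_nonneg false y
  have h1 := P.w_nonneg true y
  unfold chi
  rcases h y with e | e
  · left
    rcases mul_eq_zero.1 e with e | e
    · rw [e, min_eq_left h1, zero_div]
    · rw [e, min_eq_right h0, zero_div]
  · rw [e, min_self]
    rcases eq_or_ne (P.w true y) 0 with e' | e'
    -- Both weights vanish here, and `0 / 0 = 0` puts the symbol among the noiseless ones.
    · left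
      simp [e']
    · right
      field_simp
      norm_num

theorem IsErasure.length_masses_le {P : BMS} [Finite P.Y] (h : P.IsErasure) :
    P.masses.length ≤ 2 := by
  rw [masses_eq_massesOf]
  refine (P.length_massesOf_le _ _).trans ?_
  have hsub : Set.range P.chi ⊆ {0, 1 / 2} := by
    rintro _ ⟨y, rfl⟩
    exact h.chi_eq y
  exact (Set.ncard_le_ncard hsub (Set.toFinite _)).trans (Set.ncard_pair (by norm_num)).le

theorem IsErasure.ofMasses_masses {P : BMS} [Finite P.Y] (h : P.IsErasure)
    (hl : IsMassList P.masses) : (ofMasses P.masses hl).IsErasure := by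
  rintro ⟨i, c⟩
  have hm : (P.masses.get i) ∈ P.massesOf P.chi (Set.finite_range _) := P.masses.get_mem i
  obtain ⟨_, y, hy⟩ := mem_massesOf hm
  simp only [ofMasses]
  rcases h.chi_eq y with e | e
  · left
    rw [← hy, e]
    cases c <;> simp
  · right
    rw [← hy, e]
    norm_num

/-! ### The quantization scheme -/

open Classical in
/-- Channels with small Bhattacharyya parameter become erasure channels, other finite channels are
treated by the mass algorithm, and the remaining ones are rounded to a grid. -/
def scheme (A : MassAlgorithm) (f : ℝ → ℝ) (δ : ℝ) (k M : ℕ) (hM : 0 < M) (P : BMS) : BMS :=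
  if P.Z < δ then bec P.Z P.Z_nonneg P.Z_le_one
  else if _h : Finite P.Y then
    ofMasses (A.run f (k / 2) P.masses) (P.isMassList_masses.run A f (k / 2))
  else P.gridQuantize M hM

section scheme

variable {A : MassAlgorithm} {f : ℝ → ℝ} {δ : ℝ} {k M : ℕ} {hM : 0 < M} {P : BMS}

theorem scheme_of_lt (h : P.Z < δ) :
    scheme A f δ k M hM P = bec P.Z P.Z_nonneg P.Z_le_one := if_pos h

theorem scheme_of_finite (h : δ ≤ P.Z) [hf : Finite P.Y] : scheme A f δ k M hM P =
    ofMasses (A.run f (k / 2) P.masses) (P.isMassList_masses.run A f (k / 2)) := by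
  rw [scheme, if_neg h.not_gt, dif_pos hf]

theorem scheme_of_infinite (h : δ ≤ P.Z) (hf : ¬ Finite P.Y) :
    scheme A f δ k M hM P = P.gridQuantize M hM := by
  rw [scheme, if_neg h.not_gt, dif_neg hf]

theorem scheme_eq_ofMasses_masses (h : δ ≤ P.Z) [Finite P.Y] (hk : P.masses.length ≤ k / 2) :
    scheme A f δ k M hM P = ofMasses P.masses P.isMassList_masses := by
  rw [scheme_of_finite h]
  exact ofMasses_congr (A.run_of_length_le f hk) _ _

theorem isMassBECScheme_scheme : IsMassBECScheme A f δ k (scheme A f δ k M hM) :=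
  fun _ => ⟨scheme_of_lt, fun h _ => scheme_of_finite h⟩

theorem card_bec (e : ℝ) (h0 : 0 ≤ e) (h1 : e ≤ 1) :
    Finite (bec e h0 h1).Y ∧ Nat.card (bec e h0 h1).Y = 3 := by
  refine ⟨inferInstanceAs (Finite (Option Bool)), ?_⟩
  change Nat.card (Option Bool) = 3
  simp

theorem isQuantizer_scheme (hk : 3 ≤ k) (hkM : 2 * (M + 1) ≤ k) :
    IsQuantizer k (scheme A f δ k M hM) := by
  intro P
  rcases lt_or_ge P.Z δ with h | h
  · rw [scheme_of_lt h]
    exact ⟨(card_bec _ _ _).1, (card_bec _ _ _).2.trans_le hk⟩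
  by_cases hf : Finite P.Y
  · rw [scheme_of_finite h, card_ofMasses]
    refine ⟨finite_ofMasses _ _, ?_⟩
    have := A.length_run_le f (k := k / 2) (by omega) P.masses
    omega
  · rw [scheme_of_infinite h hf]
    exact ⟨finite_ofMasses _ _, (P.card_gridQuantize_le M hM).trans hkM⟩

/-- The case `P.Z < δ` is excluded because `BEC(Z(P))` is in general not a degraded version of `P`.
-/
theorem degrades_scheme (h : δ ≤ P.Z) : Degrades P (scheme A f δ k M hM P) := by
  by_cases hf : Finite P.Y
  · rw [scheme_of_finite h]
    intro Φ hΦ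
    rw [← P.avg_ofMasses_masses P.isMassList_masses hΦ, avg_ofMasses _ _ hΦ, avg_ofMasses _ _ hΦ]
    exact A.sum_le_sum_run f _ hΦ P.isMassList_masses P.pairwise_masses
  · rw [scheme_of_infinite h hf]
    exact P.degrades_gridQuantize M hM

theorem Z_le_Z_scheme : P.Z ≤ (scheme A f δ k M hM P).Z := by
  rcases lt_or_ge P.Z δ with h | h
  · rw [scheme_of_lt h, Z_bec]
  · exact (degrades_scheme h).Z_le

theorem T_scheme_le : (scheme A f δ k M hM P).T ≤ P.T := by
  rcases lt_or_ge P.Z δ with h | h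
  · rw [scheme_of_lt h, (isErasure_bec _ _ _).T_eq, Z_bec]
    exact P.one_sub_Z_le_T
  · exact (degrades_scheme h).T_le

/-- At most two masses, at `0` and `1/2`, fit into `k / 2 ≥ 2`, so the mass algorithm makes no step.
-/
theorem IsErasure.scheme [Finite P.Y] (h : P.IsErasure) (hk : 4 ≤ k) :
    (scheme A f δ k M hM P).IsErasure ∧ (BMS.scheme A f δ k M hM P).Z = P.Z := by
  rcases lt_or_ge P.Z δ with hZ | hZ
  · rw [scheme_of_lt hZ]
    exact ⟨isErasure_bec _ _ _, Z_bec _ _ _⟩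
  · have := h.length_masses_le
    rw [scheme_eq_ofMasses_masses hZ (by omega)]
    exact ⟨h.ofMasses_masses _, P.avg_ofMasses_masses _ isConcaveHomog_sqrt⟩

theorem IsErasure.T_scheme [Finite P.Y] (h : P.IsErasure) (hk : 4 ≤ k) :
    (BMS.scheme A f δ k M hM P).T = P.T := by
  obtain ⟨h1, h2⟩ := h.scheme (A := A) (f := f) (δ := δ) (M := M) (hM := hM) hk
  rw [h1.T_eq, h.T_eq, h2]

theorem le_Z_of_not_isErasure_scheme (h : ¬ (BMS.scheme A f δ k M hM P).IsErasure) : δ ≤ P.Z := by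
  by_contra hZ
  rw [scheme_of_lt (not_le.1 hZ)] at h
  exact h (isErasure_bec _ _ _)

theorem I_scheme_of_length_le [Finite P.Y] (h : δ ≤ P.Z) (hk : P.masses.length ≤ k / 2) :
    (BMS.scheme A f δ k M hM P).I = P.I := by
  have := P.avg_ofMasses_masses P.isMassList_masses isConcaveHomog_neg_capacityDensity
  rw [← neg_I_eq_avg, ← neg_I_eq_avg] at this
  rw [scheme_eq_ofMasses_masses h hk]
  linarith

theorem abs_I_bec_sub_le (P : BMS) : |(bec P.Z P.Z_nonneg P.Z_le_one).I - P.I| ≤ P.Z := by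
  rw [(isErasure_bec _ _ _).I_eq, (isErasure_bec _ _ _).T_eq, Z_bec, abs_le]
  constructor <;> linarith [P.I_le_one, P.one_sub_two_mul_Z_le_I]

theorem finite_scheme : Finite (scheme A f δ k M hM P).Y := by
  rcases lt_or_ge P.Z δ with h | h
  · rw [scheme_of_lt h]
    exact (card_bec _ _ _).1
  by_cases hf : Finite P.Y
  · rw [scheme_of_finite h]
    exact finite_ofMasses _ _
  · rw [scheme_of_infinite h hf]
    exact finite_ofMasses _ _

/-- The bound avoids `k`, so that alphabet sizes up to a fixed level can be controlled before `k` is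
chosen. -/
theorem card_scheme_le [Finite P.Y] :
    Nat.card (scheme A f δ k M hM P).Y ≤ 2 * Nat.card P.Y + 3 := by
  rcases lt_or_ge P.Z δ with h | h
  · rw [scheme_of_lt h, (card_bec _ _ _).2]
    omega
  · rw [scheme_of_finite h, card_ofMasses]
    have := A.length_run_le_length f (k / 2) P.masses
    have := P.length_masses_le
    omega

end scheme

theorem finite_child (P : BMS) [Finite P.Y] (b : Bool) : Finite (P.child b).Y := by
  cases b
  · exact inferInstanceAs (Finite (P.Y × P.Y))
  · exact inferInstanceAs (Finite (P.Y × P.Y × Bool))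

theorem card_child_le (P : BMS) (b : Bool) :
    Nat.card (P.child b).Y ≤ 2 * Nat.card P.Y ^ 2 := by
  cases b
  · change Nat.card (P.Y × P.Y) ≤ _
    rw [Nat.card_prod]
    nlinarith
  · change Nat.card (P.Y × P.Y × Bool) ≤ _
    rw [Nat.card_prod, Nat.card_prod, Nat.card_eq_fintype_card (α := Bool), Fintype.card_bool]
    nlinarith

/-- The invariant is an alternative: the quantized node is a degraded version of the true one, or it
is an erasure channel with a larger `Z`. The second case is hereditary since `Z(P⁻) ≤ 2Z - Z²` with
equality for erasure channels, and `Z(P⁺) = Z²`. -/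
theorem admissible_scheme (A : MassAlgorithm) (f : ℝ → ℝ) (δ : ℝ) {k M : ℕ} (hM : 0 < M)
    (hk : 4 ≤ k) : Admissible (scheme A f δ k M hM) := by
  have step : ∀ P R : BMS, Degrades P R → Degrades P (scheme A f δ k M hM R) ∨
      ((scheme A f δ k M hM R).IsErasure ∧ P.Z ≤ (scheme A f δ k M hM R).Z) := by
    intro P R h
    rcases lt_or_ge R.Z δ with hZ | hZ
    · right
      refine ⟨?_, h.Z_le.trans Z_le_Z_scheme⟩
      rw [scheme_of_lt hZ]
      exact isErasure_bec _ _ _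
    · exact Or.inl (h.trans (degrades_scheme hZ))
  have inv : ∀ (W : BMS) (n i : ℕ), Degrades (W.sub n i) (quantSub (scheme A f δ k M hM) W n i) ∨
      ((quantSub (scheme A f δ k M hM) W n i).IsErasure ∧
        (W.sub n i).Z ≤ (quantSub (scheme A f δ k M hM) W n i).Z) := by
    intro W n
    induction n with
    | zero => exact fun _ => step _ _ (Degrades.refl W)
    | succ n ih =>
      intro i
      simp only [sub, quantSub]
      set R := quantSub (scheme A f δ k M hM) W n (i / 2) with hR
      set P := W.sub n (i / 2)
      rcases ih (i / 2) with h | ⟨h, hZ⟩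
      · exact step _ _ (h.child _)
      · right
        have hfin : Finite R.Y := by
          rcases n with _ | n
          · exact finite_scheme
          · exact finite_scheme
        have := R.finite_child (i % 2 == 1)
        obtain ⟨e1, e2⟩ := (h.child (i % 2 == 1)).scheme (A := A) (f := f) (δ := δ) (M := M)
          (hM := hM) hk
        refine ⟨e1, ?_⟩
        rw [e2]
        have hP := P.Z_nonneg
        have hR1 := R.Z_le_one
        cases (i % 2 == 1)
        · change P.minus.Z ≤ R.minus.Z
          rw [h.Z_minus]
          refine P.Z_minus_le.trans ?_
          -- The map `z ↦ 2z - z²` is increasing on `[0, 1]`.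
          nlinarith
        · change P.plus.Z ≤ R.plus.Z
          rw [P.Z_plus, R.Z_plus]
          exact pow_le_pow_left₀ hP hZ 2
  intro W n i _
  rcases inv W n i with h | h
  · exact h.Z_le
  · exact h.2

end BMS

/-! ### Averages over the levels of a binary tree -/

/-- The average of `a 0, …, a (2 ^ n - 1)`. -/
def levelAvg (n : ℕ) (a : ℕ → ℝ) : ℝ := (∑ i ∈ Finset.range (2 ^ n), a i) / 2 ^ n

theorem levelAvg_zero (a : ℕ → ℝ) : levelAvg 0 a = a 0 := by simp [levelAvg]

theorem levelAvg_succ (n : ℕ) (a : ℕ → ℝ) :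
    levelAvg (n + 1) a = levelAvg n fun i => (a (2 * i) + a (2 * i + 1)) / 2 := by
  have key : ∀ m : ℕ, ∑ i ∈ Finset.range (2 * m), a i =
      ∑ i ∈ Finset.range m, (a (2 * i) + a (2 * i + 1)) := by
    intro m
    induction m with
    | zero => simp
    | succ m ih =>
      rw [show 2 * (m + 1) = 2 * m + 1 + 1 by ring, Finset.sum_range_succ, Finset.sum_range_succ,
        ih, Finset.sum_range_succ]
      ring
  unfold levelAvg
  rw [pow_succ', key, ← Finset.sum_div, pow_succ]
  field_simp

theorem levelAvg_mono {n : ℕ} {a b : ℕ → ℝ} (h : ∀ i, a i ≤ b i) : levelAvg n a ≤ levelAvg n b :=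
  div_le_div_of_nonneg_right (Finset.sum_le_sum fun i _ => h i) (by positivity)

theorem levelAvg_const (n : ℕ) (c : ℝ) : levelAvg n (fun _ => c) = c := by
  simp [levelAvg]

theorem levelAvg_add (n : ℕ) (a b : ℕ → ℝ) :
    levelAvg n (fun i => a i + b i) = levelAvg n a + levelAvg n b := by
  simp [levelAvg, Finset.sum_add_distrib, add_div]

theorem levelAvg_mul (n : ℕ) (c : ℝ) (a : ℕ → ℝ) :
    levelAvg n (fun i => c * a i) = c * levelAvg n a := by
  simp [levelAvg, ← Finset.mul_sum, mul_div_assoc]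

theorem levelAvg_sub (n : ℕ) (a b : ℕ → ℝ) :
    levelAvg n (fun i => a i - b i) = levelAvg n a - levelAvg n b := by
  simp [levelAvg, Finset.sum_sub_distrib, sub_div]

theorem abs_levelAvg_sub_le {n : ℕ} {a b d : ℕ → ℝ} {η C : ℝ}
    (h : ∀ i, |a i - b i| ≤ η + C * d i) :
    |levelAvg n a - levelAvg n b| ≤ η + C * levelAvg n d := by
  have e : η + C * levelAvg n d = levelAvg n fun i => η + C * d i := by
    rw [levelAvg_add, levelAvg_const, levelAvg_mul]
  rw [e, ← levelAvg_sub, abs_le]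
  constructor
  · have : levelAvg n (fun i => -1 * (η + C * d i)) ≤ levelAvg n fun i => a i - b i :=
      levelAvg_mono fun i => by linarith [neg_le_of_abs_le (h i)]
    rw [levelAvg_mul] at this
    linarith
  · exact levelAvg_mono fun i => (le_abs_self _).trans (h i)

/-- A labelling `t n i` of the nodes of a binary tree that satisfies the relations between the
total variation distances of a channel and of its two children. -/
structure IsPolarizing (t : ℕ → ℕ → ℝ) : Prop where
  nonneg : ∀ n i, 0 ≤ t n i
  le_one : ∀ n i, t n i ≤ 1
  left_le : ∀ n i, t (n + 1) (2 * i) ≤ t n i ^ 2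
  sum_le : ∀ n i, t (n + 1) (2 * i) + t (n + 1) (2 * i + 1) ≤ 2 * t n i

namespace IsPolarizing

variable {t : ℕ → ℕ → ℝ}

theorem antitone (h : IsPolarizing t) : Antitone fun n => levelAvg n (t n) := by
  refine antitone_nat_of_succ_le fun n => ?_
  rw [levelAvg_succ]
  exact levelAvg_mono fun i => by linarith [h.sum_le n i]

/-- With `J = 1 - t`, the children have values `u`, `v` with `u + v ≥ 2J` and `u ≥ 1 - t² = J + tJ`.
This spread of at least `tJ` around `J` makes the second moment of `1 - t` grow. -/
theorem defect_le (h : IsPolarizing t) (n : ℕ) :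
    levelAvg n (fun i => (t n i * (1 - t n i)) ^ 2) ≤
      2 * (levelAvg (n + 1) (fun i => (1 - t (n + 1) i) ^ 2) -
        levelAvg n fun i => (1 - t n i) ^ 2) := by
  rw [levelAvg_succ, ← levelAvg_sub, ← levelAvg_mul]
  refine levelAvg_mono fun i => ?_
  have h0 := h.nonneg n i
  have h1 := h.le_one n i
  have h2 := h.left_le n i
  have h3 := h.sum_le n i
  have h4 := h.le_one (n + 1) (2 * i + 1)
  have h5 := h.le_one (n + 1) (2 * i)
  set x := t n i
  set u := 1 - t (n + 1) (2 * i) with hu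
  set v := 1 - t (n + 1) (2 * i + 1) with hv
  set J := 1 - x with hJ
  have hc : 0 ≤ x * J := mul_nonneg h0 (by linarith)
  have hue : J + x * J ≤ u := by nlinarith
  have huv : 2 * J ≤ u + v := by linarith
  have hJ0 : 0 ≤ J := by linarith
  have hv0 : 0 ≤ v := by linarith
  have hsq : (x * J) ^ 2 ≤ (u - J) ^ 2 := pow_le_pow_left₀ hc (by linarith) 2
  -- For `u ≤ 2J` the bound `2J - u ≤ v` may be squared, giving `u² + v² - 2J² ≥ 2(u - J)²`; for
  -- larger `u` the square of `u` alone suffices.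
  rcases le_total u (2 * J) with hc1 | hc1
  · have : (2 * J - u) ^ 2 ≤ v ^ 2 := pow_le_pow_left₀ (by linarith) (by linarith) 2
    nlinarith
  · have : (2 * J) * J ≤ u * J := mul_le_mul_of_nonneg_right hc1 hJ0
    nlinarith [sq_nonneg v]

theorem sum_defect_le (h : IsPolarizing t) (N : ℕ) :
    ∑ n ∈ Finset.range N, levelAvg n (fun i => (t n i * (1 - t n i)) ^ 2) ≤ 2 := by
  have h1 : ∑ n ∈ Finset.range N, levelAvg n (fun i => (t n i * (1 - t n i)) ^ 2) ≤
      2 * (levelAvg N (fun i => (1 - t N i) ^ 2) - levelAvg 0 fun i => (1 - t 0 i) ^ 2) := by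
    rw [← Finset.sum_range_sub (fun n => levelAvg n fun i => (1 - t n i) ^ 2), Finset.mul_sum]
    exact Finset.sum_le_sum fun n _ => h.defect_le n
  have h2 : levelAvg N (fun i => (1 - t N i) ^ 2) ≤ 1 := by
    refine (levelAvg_mono (b := fun _ => 1) fun i => ?_).trans_eq (levelAvg_const N 1)
    exact pow_le_one₀ (by linarith [h.le_one N i]) (by linarith [h.nonneg N i])
  have h3 : 0 ≤ levelAvg 0 fun i => (1 - t 0 i) ^ 2 := by
    rw [levelAvg_zero]
    positivity
  linarith

theorem defect_nonneg (t : ℕ → ℕ → ℝ) (n : ℕ) :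
    0 ≤ levelAvg n fun i => (t n i * (1 - t n i)) ^ 2 := by
  rw [← levelAvg_const n 0]
  exact levelAvg_mono fun i => sq_nonneg _

theorem tendsto_defect (h : IsPolarizing t) :
    Tendsto (fun n => levelAvg n fun i => (t n i * (1 - t n i)) ^ 2) atTop (𝓝 0) :=
  (summable_of_sum_range_le (defect_nonneg t) h.sum_defect_le).tendsto_atTop_zero

/-- Pigeonhole on `sum_defect_le`. The range of levels to be searched is the same for all trees,
hence can be fixed before `k`. -/
theorem exists_defect_le (h : IsPolarizing t) {N : ℕ} (hN : 0 < N) :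
    ∃ n < N, levelAvg n (fun i => (t n i * (1 - t n i)) ^ 2) ≤ 2 / N := by
  by_contra! hcon
  have hN' : (0 : ℝ) < N := Nat.cast_pos.2 hN
  have : ∑ n ∈ Finset.range N, (2 / N : ℝ) <
      ∑ n ∈ Finset.range N, levelAvg n (fun i => (t n i * (1 - t n i)) ^ 2) :=
    Finset.sum_lt_sum_of_nonempty (Finset.nonempty_range_iff.2 hN.ne') fun n hn =>
      hcon n (Finset.mem_range.1 hn)
  rw [Finset.sum_const, Finset.card_range, nsmul_eq_mul, mul_div_cancel₀ _ hN'.ne'] at this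
  linarith [h.sum_defect_le N]

end IsPolarizing

/-! ### From small defect to extreme channels and good fractions -/

namespace BMS

theorem quantSub_even (Q : BMS → BMS) (W : BMS) (n i : ℕ) :
    quantSub Q W (n + 1) (2 * i) = Q (quantSub Q W n i).minus := by
  rw [quantSub, show 2 * i / 2 = i by omega, show 2 * i % 2 = 0 by omega]
  rfl

theorem quantSub_odd (Q : BMS → BMS) (W : BMS) (n i : ℕ) :
    quantSub Q W (n + 1) (2 * i + 1) = Q (quantSub Q W n i).plus := by
  rw [quantSub, show (2 * i + 1) / 2 = i by omega, show (2 * i + 1) % 2 = 1 by omega]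
  rfl

open Classical in
/-- Almost extreme channels: the total variation distance is close to the capacity and to the
indicator of good channels. -/
theorem exists_polarization_bound {η : ℝ} (hη : 0 < η) (hη' : η ≤ 1 / 2) :
    ∃ C, 0 ≤ C ∧ ∀ P : BMS, |P.I - P.T| ≤ η + C * (P.T * (1 - P.T)) ^ 2 ∧
      |(if 1 / 2 < P.I then 1 else 0) - P.T| ≤ η + C * (P.T * (1 - P.T)) ^ 2 := by
  -- If `1 - T < κ`, then `Z² ≤ 1 - T² ≤ 2(1 - T) < (η / 4)²`, so `I ≥ 1 - 2Z` exceeds both `1 - η`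
  -- and `1/2`.
  set κ : ℝ := η ^ 2 / 32 with hκ
  have hκ0 : 0 < κ := by positivity
  have hκη : κ ≤ η := by nlinarith
  -- In the middle range `η ≤ T ≤ 1 - κ` this constant lifts the defect term to at least `1`, which
  -- bounds both left sides.
  refine ⟨1 / (η * κ) ^ 2, by positivity, fun P => ?_⟩
  have hT0 := P.T_nonneg
  have hT1 := P.T_le_one
  have hI0 := P.I_nonneg
  have hIT := P.I_le_T
  have hZI := P.one_sub_two_mul_Z_le_I
  have hZ0 := P.Z_nonneg
  have hZT := P.sq_Z_add_sq_T_le_one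
  have hD : 0 ≤ 1 / (η * κ) ^ 2 * (P.T * (1 - P.T)) ^ 2 := by positivity
  rcases lt_or_ge P.T η with h | h
  · rw [if_neg (by linarith), abs_le, abs_le]
    refine ⟨⟨?_, ?_⟩, ?_, ?_⟩ <;> linarith
  rcases lt_or_ge (1 - P.T) κ with h' | h'
  · have hZ : P.Z < η / 4 := by
      refine lt_of_pow_lt_pow_left₀ 2 (by positivity) ?_
      nlinarith
    rw [if_pos (by linarith), abs_le, abs_le]
    refine ⟨⟨?_, ?_⟩, ?_, ?_⟩ <;> linarith
  · have h1 : η * κ ≤ P.T * (1 - P.T) := mul_le_mul h h' hκ0.le hT0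
    have h2 : 1 ≤ 1 / (η * κ) ^ 2 * (P.T * (1 - P.T)) ^ 2 := by
      rw [one_div_mul_eq_div, one_le_div (by positivity)]
      exact pow_le_pow_left₀ (by positivity) h1 2
    refine ⟨?_, ?_⟩
    · rw [abs_le]
      constructor <;> linarith
    · rw [abs_le]
      split_ifs <;> constructor <;> linarith

/-- From `Z ≥ δ` and `Z² + T² ≤ 1` follows `1 - T ≥ δ² / 2`. So either `T < η` or the defect is
bounded below. -/
theorem exists_T_le_of_le_Z {η δ : ℝ} (hη : 0 < η) (hδ : 0 < δ) :
    ∃ C, 0 ≤ C ∧ ∀ P : BMS, δ ≤ P.Z → P.T ≤ η + C * (P.T * (1 - P.T)) ^ 2 := by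
  refine ⟨1 / (η * (δ ^ 2 / 2)) ^ 2, by positivity, fun P hP => ?_⟩
  have hT0 := P.T_nonneg
  have hT1 := P.T_le_one
  have hZT := P.sq_Z_add_sq_T_le_one
  have hD : 0 ≤ 1 / (η * (δ ^ 2 / 2)) ^ 2 * (P.T * (1 - P.T)) ^ 2 := by positivity
  rcases lt_or_ge P.T η with h | h
  · linarith
  have h' : δ ^ 2 / 2 ≤ 1 - P.T := by
    have := pow_le_pow_left₀ hδ.le hP 2
    nlinarith
  have h1 : η * (δ ^ 2 / 2) ≤ P.T * (1 - P.T) := mul_le_mul h h' (by positivity) hT0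
  have h2 : 1 ≤ 1 / (η * (δ ^ 2 / 2)) ^ 2 * (P.T * (1 - P.T)) ^ 2 := by
    rw [one_div_mul_eq_div, one_le_div (by positivity)]
    exact pow_le_pow_left₀ (by positivity) h1 2
  linarith

/-- If the total variation distances polarize, then the fraction of good channels converges to the
limit of their averages. -/
theorem isGoodFraction_of_tendsto {Q : BMS → BMS} {W : BMS} {ρ : ℝ}
    (h : IsPolarizing fun n i => (quantSub Q W n i).T)
    (hρ : Tendsto (fun n => levelAvg n fun i => (quantSub Q W n i).T) atTop (𝓝 ρ)) :
    IsGoodFraction Q W ρ := by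
  classical
  unfold IsGoodFraction
  have e : ∀ n : ℕ, (((Finset.range (2 ^ n)).filter
      fun i => 1 / 2 < (quantSub Q W n i).I).card : ℝ) / 2 ^ n =
      levelAvg n fun i => if 1 / 2 < (quantSub Q W n i).I then 1 else 0 := by
    intro n
    rw [levelAvg, Finset.sum_boole]
  have hd : Tendsto (fun n : ℕ => (levelAvg n fun i => if 1 / 2 < (quantSub Q W n i).I then 1
      else 0) - levelAvg n fun i => (quantSub Q W n i).T) atTop (𝓝 0) := by
    rw [Metric.tendsto_atTop]
    intro ε hε
    obtain ⟨C, hC0, hC⟩ := exists_polarization_bound (η := min (ε / 2) (1 / 2)) (by positivity)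
      (min_le_right _ _)
    have hlim := h.tendsto_defect.const_mul C
    rw [mul_zero] at hlim
    obtain ⟨N, hN⟩ := eventually_atTop.1 (hlim.eventually (gt_mem_nhds (half_pos hε)))
    refine ⟨N, fun n hn => ?_⟩
    rw [dist_zero_right, Real.norm_eq_abs]
    refine (abs_levelAvg_sub_le fun i => (hC (quantSub Q W n i)).2).trans_lt ?_
    have := hN n hn
    have := min_le_left (ε / 2) (1 / 2)
    linarith
  have := hd.add hρ
  simp only [sub_add_cancel, zero_add] at this
  refine this.congr fun n => ?_
  rw [← e]

end BMS

/-! ### The quantized tree of the scheme -/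

namespace BMS

section tree

variable {A : MassAlgorithm} {f : ℝ → ℝ} {δ : ℝ} {k M : ℕ} {hM : 0 < M} (W : BMS)

theorem finite_quantSub_scheme (n i : ℕ) :
    Finite (quantSub (scheme A f δ k M hM) W n i).Y := by
  cases n <;> exact finite_scheme

theorem isPolarizing_scheme :
    IsPolarizing fun n i => (quantSub (scheme A f δ k M hM) W n i).T where
  nonneg _ _ := T_nonneg _
  le_one _ _ := T_le_one _
  left_le n i := by
    rw [quantSub_even, ← T_minus]
    exact T_scheme_le
  sum_le n i := by
    rw [quantSub_even, quantSub_odd]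
    exact (add_le_add T_scheme_le T_scheme_le).trans (T_minus_add_T_plus_le _)

open Classical in
/-- The contribution of the erasure channels to the average does not decrease with the level. -/
theorem monotone_levelAvg_erasure (hk : 4 ≤ k) : Monotone fun n => levelAvg n fun i =>
    if (quantSub (scheme A f δ k M hM) W n i).IsErasure then
      (quantSub (scheme A f δ k M hM) W n i).T else 0 := by
  refine monotone_nat_of_le_succ fun n => ?_
  rw [levelAvg_succ]
  refine levelAvg_mono fun i => ?_
  rw [quantSub_even, quantSub_odd]
  have hfin := finite_quantSub_scheme (A := A) (f := f) (δ := δ) (k := k) (hM := hM) W n i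
  set R := quantSub (scheme A f δ k M hM) W n i
  by_cases hR : R.IsErasure
  · have f1 : Finite R.minus.Y := R.finite_child false
    have f2 : Finite R.plus.Y := R.finite_child true
    rw [if_pos hR, if_pos (hR.minus.scheme hk).1, if_pos (hR.plus.scheme hk).1,
      hR.minus.T_scheme hk, hR.plus.T_scheme hk, hR.T_minus_add_T_plus]
    linarith
  · rw [if_neg hR]
    have : ∀ P : BMS, 0 ≤ if P.IsErasure then P.T else 0 := fun P => by
      split_ifs
      · exact P.T_nonneg
      · exact le_rfl
    exact div_nonneg (add_nonneg (this _) (this _)) (by norm_num)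

open Classical in
/-- As long as no masses are joined, capacity is lost only when a channel first becomes an
erasure channel. -/
theorem abs_I_scheme_sub_add_le {P R : BMS} [Finite P.Y] (hδ : 0 ≤ δ) (hk : 4 ≤ k)
    (hPk : P.masses.length ≤ k / 2) (hRP : R.IsErasure → P.IsErasure) :
    |(scheme A f δ k M hM P).I - P.I| +
      (if (scheme A f δ k M hM P).IsErasure then 0 else δ) ≤ if R.IsErasure then 0 else δ := by
  by_cases hR : R.IsErasure
  · have hP := hRP hR
    rw [if_pos hR, if_pos (hP.scheme hk).1, (hP.scheme hk).1.I_eq, hP.T_scheme hk, hP.I_eq]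
    simp
  · rw [if_neg hR]
    rcases lt_or_ge P.Z δ with hZ | hZ
    · rw [scheme_of_lt hZ, if_pos (isErasure_bec _ _ _)]
      -- The change of capacity is at most `Z(P) < δ`, paid from the credit `δ` of the non-erasure
      -- parent.
      linarith [P.abs_I_bec_sub_le]
    · rw [I_scheme_of_length_le hZ hPk, sub_self, abs_zero, zero_add]
      split_ifs <;> linarith

/-- A bound for the alphabet sizes in the quantized tree that does not depend on `k`. -/
def cardBound (c : ℕ) : ℕ → ℕ
  | 0 => c
  | n + 1 => 2 * (2 * cardBound c n ^ 2) + 3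

theorem monotone_cardBound (c : ℕ) : Monotone (cardBound c) := by
  refine monotone_nat_of_le_succ fun n => ?_
  rw [cardBound]
  nlinarith

theorem card_quantSub_scheme_le (n i : ℕ) :
    Nat.card (quantSub (scheme A f δ k M hM) W n i).Y ≤
      cardBound (2 * Nat.card W.Y + 3 + 2 * (M + 1)) n := by
  induction n generalizing i with
  | zero =>
    rw [quantSub, cardBound]
    by_cases hf : Finite W.Y
    · exact card_scheme_le.trans (by omega)
    · rcases lt_or_ge W.Z δ with h | h
      · rw [scheme_of_lt h, (card_bec _ _ _).2]
        omega
      · rw [scheme_of_infinite h hf]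
        exact (W.card_gridQuantize_le M hM).trans (by omega)
  | succ n ih =>
    have hfin := finite_quantSub_scheme (A := A) (f := f) (δ := δ) (k := k) (hM := hM) W n (i / 2)
    rw [quantSub, cardBound]
    have := finite_child (quantSub (scheme A f δ k M hM) W n (i / 2)) (i % 2 == 1)
    refine card_scheme_le.trans ?_
    have h1 := card_child_le (quantSub (scheme A f δ k M hM) W n (i / 2)) (i % 2 == 1)
    have h2 := Nat.pow_le_pow_left (ih (i / 2)) 2
    omega

/-- A node that is not yet an erasure channel holds a credit `δ`, spent once when its descendants
become erasure channels. Since `I(P⁻) + I(P⁺) = 2 I(P)`, the averages of `I + e` decrease and those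
of `I - e` increase along the levels. -/
theorem abs_levelAvg_I_sub_le (hδ : 0 ≤ δ) (hk : 4 ≤ k) {N : ℕ}
    (hkN : cardBound (2 * Nat.card W.Y + 3 + 2 * (M + 1)) N ≤ k / 2) {n : ℕ} (hn : n ≤ N) :
    |levelAvg n (fun i => (quantSub (scheme A f δ k M hM) W n i).I) -
      (scheme A f δ k M hM W).I| ≤ δ := by
  classical
  set R := quantSub (scheme A f δ k M hM) W with hR
  set e : BMS → ℝ := fun P => if P.IsErasure then 0 else δ with he
  have he0 : ∀ P, 0 ≤ e P := fun P => by
    simp only [he]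
    split_ifs <;> linarith
  have heδ : ∀ P, e P ≤ δ := fun P => by
    simp only [he]
    split_ifs <;> linarith
  have hstep : ∀ n < N, ∀ i, ∀ b : Bool,
      |(scheme A f δ k M hM ((R n i).child b)).I - ((R n i).child b).I| +
        e (scheme A f δ k M hM ((R n i).child b)) ≤ e (R n i) := by
    intro n hn i b
    have hfin : Finite (R n i).Y := finite_quantSub_scheme W n i
    have := (R n i).finite_child b
    refine abs_I_scheme_sub_add_le hδ hk ?_ fun h => h.child b
    refine (length_masses_le _).trans ((card_child_le _ b).trans ?_)
    have h1 : Nat.card (R n i).Y ≤ _ := card_quantSub_scheme_le W n i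
    have h2 := Nat.pow_le_pow_left h1 2
    -- The children formed at level `n + 1 ≤ N` still have at most `k / 2` symbols before
    -- quantization, so no masses are joined.
    have h3 := (monotone_cardBound (2 * Nat.card W.Y + 3 + 2 * (M + 1)) hn).trans hkN
    rw [Nat.succ_eq_add_one, cardBound] at h3
    omega
  have main : ∀ n ≤ N,
      levelAvg n (fun i => (R n i).I + e (R n i)) ≤ (R 0 0).I + δ ∧
      (R 0 0).I - δ ≤ levelAvg n (fun i => (R n i).I - e (R n i)) := by
    intro n
    induction n with
    | zero =>
      intro _
      rw [levelAvg_zero, levelAvg_zero]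
      constructor <;> linarith [heδ (R 0 0)]
    | succ n ih =>
      intro hn
      obtain ⟨h1, h2⟩ := ih (by omega)
      rw [levelAvg_succ, levelAvg_succ]
      have key : ∀ i, |(R (n + 1) (2 * i)).I - (R n i).minus.I| + e (R (n + 1) (2 * i)) ≤
            e (R n i) ∧
          |(R (n + 1) (2 * i + 1)).I - (R n i).plus.I| + e (R (n + 1) (2 * i + 1)) ≤
            e (R n i) := by
        intro i
        rw [hR, quantSub_even, quantSub_odd]
        exact ⟨hstep n (by omega) i false, hstep n (by omega) i true⟩
      constructor
      · refine le_trans (levelAvg_mono fun i => ?_) h1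
        obtain ⟨k1, k2⟩ := key i
        have := (R n i).I_minus_add_I_plus
        linarith [le_abs_self ((R (n + 1) (2 * i)).I - (R n i).minus.I),
          le_abs_self ((R (n + 1) (2 * i + 1)).I - (R n i).plus.I)]
      · refine h2.trans (levelAvg_mono fun i => ?_)
        obtain ⟨k1, k2⟩ := key i
        have := (R n i).I_minus_add_I_plus
        linarith [neg_abs_le ((R (n + 1) (2 * i)).I - (R n i).minus.I),
          neg_abs_le ((R (n + 1) (2 * i + 1)).I - (R n i).plus.I)]
  obtain ⟨h1, h2⟩ := main n hn
  have u1 : levelAvg n (fun i => (R n i).I) ≤ levelAvg n (fun i => (R n i).I + e (R n i)) :=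
    levelAvg_mono fun i => by linarith [he0 (R n i)]
  have u2 : levelAvg n (fun i => (R n i).I - e (R n i)) ≤ levelAvg n (fun i => (R n i).I) :=
    levelAvg_mono fun i => by linarith [he0 (R n i)]
  have e0 : (R 0 0).I = (scheme A f δ k M hM W).I := rfl
  rw [abs_le]
  constructor <;> linarith

/-- Only the root can have an infinite alphabet. Then `Nat.card W.Y = 0` makes `hk` void, and either
the erasure step or the grid is used. -/
theorem abs_I_scheme_root_sub_le (hδ : 0 ≤ δ) {ε : ℝ} (hε : 0 ≤ ε)
    (hgrid : |(W.gridQuantize M hM).I - W.I| ≤ ε) (hk : Nat.card W.Y ≤ k / 2) :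
    |(scheme A f δ k M hM W).I - W.I| ≤ δ + ε := by
  rcases lt_or_ge W.Z δ with h | h
  · rw [scheme_of_lt h]
    linarith [W.abs_I_bec_sub_le]
  by_cases hf : Finite W.Y
  · rw [I_scheme_of_length_le h (W.length_masses_le.trans hk), sub_self, abs_zero]
    linarith
  · rw [scheme_of_infinite h hf]
    linarith

/-- Such a node was formed by a mass or grid step from a channel with `Z ≥ δ`, and quantization does
not lower `Z`. -/
theorem le_Z_of_not_isErasure_quantSub {n i : ℕ}
    (h : ¬ (quantSub (scheme A f δ k M hM) W n i).IsErasure) :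
    δ ≤ (quantSub (scheme A f δ k M hM) W n i).Z := by
  cases n <;> exact (le_Z_of_not_isErasure_scheme h).trans Z_le_Z_scheme

end tree

end BMS

end

/-! ### Choice of the parameters and conclusion -/

theorem theorem2 (W : BMS) (A : MassAlgorithm) (f : ℝ → ℝ)
    (hf : MonotoneOn f (Set.Icc 0 (1 / 2)))
    (hfc : A = MassAlgorithm.merging → ConcaveOn ℝ (Set.Icc 0 (1 / 2)) f)
    (ε : ℝ) (hε : 0 < ε) :
    ∃ δ₀ : ℝ, 0 < δ₀ ∧ ∀ δ : ℝ, 0 < δ → δ ≤ δ₀ →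
      ∃ K : ℕ, ∀ k : ℕ, K ≤ k →
        ∃ Q : BMS → BMS,
          IsQuantizer k Q ∧ IsMassBECScheme A f δ k Q ∧ Admissible Q ∧
            ∃ ρ : ℝ, IsGoodFraction Q W ρ ∧ |ρ - W.I| < ε := by
  classical
  obtain ⟨M, hM, hgrid⟩ := BMS.exists_abs_I_gridQuantize_sub_le (ε := ε / 8) (by positivity)
  refine ⟨ε / 8, by positivity, fun δ hδ hδε => ?_⟩
  set η := min (ε / 16) (1 / 2) with hη
  have hη0 : 0 < η := by positivity
  have hηε : η ≤ ε / 16 := min_le_left _ _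
  obtain ⟨C, hC0, hC⟩ := BMS.exists_polarization_bound hη0 (min_le_right _ _)
  obtain ⟨C', hC'0, hC'⟩ := BMS.exists_T_le_of_le_Z hη0 hδ
  -- A level with defect at most `2 / N` then has `(C + C') * D ≤ η`. The choice of `N` precedes
  -- that of `k`.
  obtain ⟨N, hN⟩ := exists_nat_gt (2 * (C + C') / η)
  have hN0 : (0 : ℝ) < N := lt_of_le_of_lt (by positivity) hN
  -- This bounds the alphabet of the quantized root: mass step, erasure channel or grid. An infinite
  -- `W.Y` counts as `0`.
  set c := 2 * Nat.card W.Y + 3 + 2 * (M + 1) with hc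
  refine ⟨2 * BMS.cardBound c N, fun k hk => ?_⟩
  have hcN : c ≤ BMS.cardBound c N := BMS.monotone_cardBound c (Nat.zero_le N)
  have hk4 : 4 ≤ k := by omega
  have hkN : BMS.cardBound c N ≤ k / 2 := by omega
  refine ⟨BMS.scheme A f δ k M hM, BMS.isQuantizer_scheme (by omega) (by omega),
    BMS.isMassBECScheme_scheme, BMS.admissible_scheme A f δ hM hk4, ?_⟩
  set R := BMS.quantSub (BMS.scheme A f δ k M hM) W with hR
  have hpol : IsPolarizing fun n i => (R n i).T := BMS.isPolarizing_scheme W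
  set S : ℕ → ℝ := fun n => levelAvg n fun i => (R n i).T with hS
  set B : ℕ → ℝ := fun n => levelAvg n fun i => if (R n i).IsErasure then (R n i).T else 0 with hB
  have hSanti : Antitone S := hpol.antitone
  have hBmono : Monotone B := BMS.monotone_levelAvg_erasure W hk4
  have hBS : ∀ n, B n ≤ S n := fun n => levelAvg_mono fun i => by
    split_ifs
    · exact le_rfl
    · exact BMS.T_nonneg _
  have hbdd : BddBelow (Set.range S) := ⟨B 0, by
    rintro _ ⟨n, rfl⟩
    exact (hBmono (Nat.zero_le n)).trans (hBS n)⟩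
  have hlim := tendsto_atTop_ciInf hSanti hbdd
  set ρ := ⨅ n, S n with hρ
  refine ⟨ρ, BMS.isGoodFraction_of_tendsto hpol hlim, ?_⟩
  obtain ⟨n, hnN, hD⟩ := hpol.exists_defect_le (Nat.cast_pos.1 hN0)
  set D := levelAvg n fun i => ((R n i).T * (1 - (R n i).T)) ^ 2 with hDdef
  have hCD : (C + C') * D ≤ η := by
    refine (mul_le_mul_of_nonneg_left hD (by positivity)).trans ?_
    rw [div_lt_iff₀ hη0] at hN
    rw [← mul_div_assoc, div_le_iff₀ hN0]
    linarith
  have hD0 : 0 ≤ D := IsPolarizing.defect_nonneg (fun n i => (R n i).T) n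
  have hCD' : C * D + C' * D ≤ η := by linarith
  have hup : ρ ≤ S n := hSanti.le_of_tendsto hlim n
  -- The later values `S m` stay above `B m ≥ B n`, so `ρ` is trapped between `B n` and `S n`.
  have hlow : B n ≤ ρ := ge_of_tendsto hlim (eventually_atTop.2
    ⟨n, fun m hm => (hBmono hm).trans (hBS m)⟩)
  have hSB : |S n - B n| ≤ η + C' * D := by
    refine abs_levelAvg_sub_le fun i => ?_
    have h0 : 0 ≤ C' * ((R n i).T * (1 - (R n i).T)) ^ 2 := by positivity
    split_ifs with h
    · rw [sub_self, abs_zero]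
      linarith
    · rw [sub_zero, abs_of_nonneg (BMS.T_nonneg _)]
      exact hC' _ (BMS.le_Z_of_not_isErasure_quantSub W h)
  have hIS : |levelAvg n (fun i => (R n i).I) - S n| ≤ η + C * D :=
    abs_levelAvg_sub_le fun i => (hC (R n i)).1
  have hI : |levelAvg n (fun i => (R n i).I) - (BMS.scheme A f δ k M hM W).I| ≤ δ :=
    BMS.abs_levelAvg_I_sub_le W hδ.le hk4 hkN hnN.le
  have hroot : |(BMS.scheme A f δ k M hM W).I - W.I| ≤ δ + ε / 8 :=
    BMS.abs_I_scheme_root_sub_le W hδ.le (by positivity) (hgrid W) (by omega)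
  have hCD1 : 0 ≤ C * D := by positivity
  have hCD2 : 0 ≤ C' * D := by positivity
  rw [abs_le] at hSB hIS hI hroot
  rw [abs_lt]
  -- The errors add up to at most `3η + 2δ + ε / 8 ≤ 9ε / 16`.
  constructor <;> linarith [hSB.1, hSB.2, hIS.1, hIS.2, hI.1, hI.2, hroot.1, hroot.2]
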